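/- **Setting.** Let $n\ge 2$, $m\ge 1$, and consider $\min_{x\in\mathbb R^d}F(x)=\sum_{i=1}^n\big(\frac{\sigma_i}{2}\|x\|^2+\sum_{j=1}^m f_{ij}(x)\big)$ with $\sigma_i>0$ and each $f_{ij}$ convex and $L_{ij}$-smooth; let $\theta^\star$ be the minimizer. The nodes $1,\dots,n$ are linked by an undirected graph with edge weights $\mu_{k\ell}$; $A_{\rm comm}$ is the matrix with columns $\mu_{k\ell}(u_k-u_\ell)$ (one for each edge, $u_k$ the unit vectors of $\mathbb R^n$), and the gossip matrix $W=A_{\rm comm}A_{\rm comm}^\top$ is assumed to satisfy $\mathrm{Ker}\,W=\mathrm{Span}(\mathbf 1)$. With $\lambda_{\max}$, $\lambda_{\min}^+$ the largest and the smallest non-zero eigenvalue, put $\gamma=\lambda_{\min}^+(W)/\lambda_{\max}(W)$, $\Sigma=\mathrm{Diag}(\sigma_i^{-1})$, $D_M=\mathrm{Diag}\big(\sigma_i+\lambda_{\max}(\sum_j L_{ij}P_{ij})\big)$, where $P_{ij}$ is the orthogonal projector on the orthogonal complement of the space of directions along which $\nabla f_{ij}$ is constant (the intersection of the kernels of the Hessians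 $\nabla^2f_{ij}(x)$ if $f_{ij}$ is twice differentiable), $\kappa_s=\max_i\big(1+\sum_jL_{ij}/\sigma_i\big)$ and $\kappa_{\rm comm}=\gamma\,\lambda_{\max}(A_{\rm comm}^\top\Sigma A_{\rm comm})/\lambda_{\min}^+(A_{\rm comm}^\top D_M^{-1}A_{\rm comm})$. **Algorithm (DVR).** Let $p_{\rm comm}=\big(1+\gamma\frac{m+\kappa_s}{\kappa_{\rm comm}}\big)^{-1}$, let $p_{ij}$ be proportional in $j$ to $(1-p_{\rm comm})(1+L_{ij}/\sigma_i)$ with $\sum_jp_{ij}=1-p_{\rm comm}$, and let $\alpha=2\lambda_{\min}^+(A_{\rm comm}^\top D_M^{-1}A_{\rm comm})$ and $\eta=\min\Big(\frac{p_{\rm comm}}{\lambda_{\max}(A_{\rm comm}^\top\Sigma A_{\rm comm})},\ \min_{i,j}\frac{p_{ij}}{\alpha(1+L_{ij}/\sigma_i)}\Big)$. Start from an arbitrary $z_0=(z_0^{(ij)})$ and $\theta_0^{(i)}=-\sigma_i^{-1}\sum_j\nabla f_{ij}(z_0^{(ij)})$. At each iteration, independently of the past, with probability $p_{\rm comm}$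 perform a communication step $\theta_{t+1}=\theta_t-\frac{\eta}{p_{\rm comm}}\Sigma W\theta_t$, $z_{t+1}=z_t$; otherwise perform a computation step: each node $i$, independently, samples one index $j$ with (conditional) probability $p_{ij}/(1-p_{\rm comm})$, sets $z_{t+1}^{(ij)}=\big(1-\frac{\alpha\eta}{p_{ij}}\big)z_t^{(ij)}+\frac{\alpha\eta}{p_{ij}}\theta_t^{(i)}$, leaves $z^{(ij')}$ unchanged for $j'\ne j$, and sets $\theta_{t+1}^{(i)}=\theta_t^{(i)}-\frac1{\sigma_i}\big(\nabla f_{ij}(z_{t+1}^{(ij)})-\nabla f_{ij}(z_t^{(ij)})\big)$. A communication step takes time $\tau\ge0$, a computation step takes time $1$. **Theorem.** There is an absolute constant $c>0$ such that for every problem as above and every $z_0$ there is $C_0>0$, depending only on the problem and on the initial point $z_0$, such that for all $t\ge0$ $$\mathbb E\Big[\sum_{i=1}^n\tfrac12\|\theta_t^{(i)}-\theta^\star\|^2\Big]\le C_0\Big(1-\frac{\alpha\eta}{2}\Big)^t .$$ Moreover, for all $\tau\ge0$ and all $0<\varepsilon\le\min(\frac12,\frac1{C_0})$ there is a number of iterations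 $K_\varepsilon$ such that the expected error above is at most $\varepsilon$ for all $t\ge K_\varepsilon$, and the expected time $T_\varepsilon$ taken by the first $K_\varepsilon$ iterations satisfies $$T_\varepsilon\le c\,\Big[2(m+\kappa_s)+\tau\,\frac{\kappa_{\rm comm}}{\gamma}\Big]\log\varepsilon^{-1}.$$ -/

import Mathlib

open MeasureTheory ProbabilityTheory
open scoped Matrix Gradient

noncomputable section

namespace DVR

/-- Largest eigenvalue of a linear operator (used only for symmetric positive semi-definite ones,
in finite dimension). -/
def lamMax {V : Type*} [AddCommGroup V] [Module ℝ V] (T : Module.End ℝ V) : ℝ :=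
  sSup {x : ℝ | T.HasEigenvalue x}

/-- Smallest non-zero eigenvalue of a linear operator (same remark). -/
def lamMinPos {V : Type*} [AddCommGroup V] [Module ℝ V] (T : Module.End ℝ V) : ℝ :=
  sInf {x : ℝ | T.HasEigenvalue x ∧ x ≠ 0}

/-- `Ker(f)`: the directions along which the gradient of `f` does not vary. For a twice
differentiable `f` this is the intersection of the kernels of all the Hessians of `f`, see
`mem_kerHess_iff`; the definition below makes sense for every function with a gradient. -/
def kerHess {E : Type*} [NormedAddCommGroup E] [InnerProductSpace ℝ E] [CompleteSpace E]
    (f : E → ℝ) : Submodule ℝ E where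
  carrier := {v | ∀ (x : E) (s : ℝ), ∇ f (x + s • v) = ∇ f x}
  zero_mem' := by intro x s; simp
  add_mem' := by
    intro v w hv hw x s
    rw [smul_add, ← add_assoc, hw, hv]
  smul_mem' := by
    intro c v hv x s
    rw [smul_smul]
    exact hv x _

/-- Agreement with the definition through Hessians. -/
theorem mem_kerHess_iff {E : Type*} [NormedAddCommGroup E] [InnerProductSpace ℝ E]
    [CompleteSpace E] {f : E → ℝ} (hf : Differentiable ℝ (∇ f)) (v : E) :
    v ∈ kerHess f ↔ ∀ x : E, fderiv ℝ (∇ f) x v = 0 := by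
  have hline : ∀ (x : E) (s : ℝ),
      HasDerivAt (fun r : ℝ => ∇ f (x + r • v)) (fderiv ℝ (∇ f) (x + s • v) v) s := by
    intro x s
    have h1 : HasDerivAt (fun r : ℝ => x + r • v) v s := by
      simpa using ((hasDerivAt_id s).smul_const v).const_add x
    exact (hf (x + s • v)).hasFDerivAt.comp_hasDerivAt s h1
  constructor
  · intro hv x
    have h := hline x 0
    have hc : (fun r : ℝ => ∇ f (x + r • v)) = fun _ => ∇ f x := funext fun r => hv x r
    rw [hc] at h
    simpa using h.unique (hasDerivAt_const (0 : ℝ) (∇ f x))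
  · intro hv x s
    have h := is_const_of_deriv_eq_zero (f := fun r : ℝ => ∇ f (x + r • v))
      (fun r => (hline x r).differentiableAt)
      (fun r => by rw [(hline x r).deriv, hv]) s 0
    simpa using h

/-- The edges of a graph on `Fin n`, each listed once, as a pair `(k, ℓ)` with `k < ℓ`. -/
abbrev Edge {n : ℕ} (G : SimpleGraph (Fin n)) : Type :=
  {e : Fin n × Fin n // e.1 < e.2 ∧ G.Adj e.1 e.2}

instance {n : ℕ} (G : SimpleGraph (Fin n)) : Fintype (Edge G) := Fintype.ofFinite _

/-- The matrix `A_comm`, with columns `μ_{kℓ} (u_k - u_ℓ)`. (The matrix acting on vectors of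
`ℝ^d` attached to the edges is `A_comm ⊗ I_d`, which has the same spectral quantities.) -/
def Acomm {n : ℕ} (G : SimpleGraph (Fin n)) (μ : Edge G → ℝ) : Matrix (Fin n) (Edge G) ℝ :=
  fun i e => μ e * ((if i = e.1.1 then 1 else 0) - (if i = e.1.2 then 1 else 0))

/-- The gossip matrix `W = A_comm A_commᵀ`. -/
def gossip {n : ℕ} (G : SimpleGraph (Fin n)) (μ : Edge G → ℝ) : Matrix (Fin n) (Fin n) ℝ :=
  Acomm G μ * (Acomm G μ)ᵀ

/-- A decentralized regularized finite-sum problem: `n` nodes, `m` samples per node, parameters in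
`ℝ^d`, with the standing assumptions on the local functions and on the network. -/
structure Problem (n m d : ℕ) where
  /-- the communication network -/
  G : SimpleGraph (Fin n)
  /-- the weights of the edges of the network -/
  μ : Edge G → ℝ
  /-- the local regularization parameters -/
  σ : Fin n → ℝ
  /-- the local losses -/
  f : Fin n → Fin m → EuclideanSpace ℝ (Fin d) → ℝ
  /-- the smoothness constants of the losses -/
  L : Fin n → Fin m → NNReal
  σ_pos : ∀ i, 0 < σ i
  convex : ∀ i j, ConvexOn ℝ Set.univ (f i j)
  differentiable : ∀ i j, Differentiable ℝ (f i j)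
  smooth : ∀ i j, LipschitzWith (L i j) (∇ (f i j))
  ker_gossip : LinearMap.ker (gossip G μ).mulVecLin = Submodule.span ℝ {fun _ => (1 : ℝ)}

namespace Problem

variable {n m d : ℕ} (S : Problem n m d)

/-- The objective `F(x) = ∑ i, (σ_i / 2 ‖x‖² + ∑ j, f_ij(x))`. -/
def F (x : EuclideanSpace ℝ (Fin d)) : ℝ :=
  ∑ i, (S.σ i / 2 * ‖x‖ ^ 2 + ∑ j, S.f i j x)

/-- The gossip matrix of the network. -/
def W : Matrix (Fin n) (Fin n) ℝ := gossip S.G S.μ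

/-- The spectral gap `γ = λ_min⁺(W) / λ_max(W)`. -/
def γ : ℝ := lamMinPos S.W.mulVecLin / lamMax S.W.mulVecLin

/-- The stochastic condition number `κ_s = max_i (1 + ∑ j, L_ij / σ_i)`. -/
def κs : ℝ := ⨆ i, (1 + (∑ j, (S.L i j : ℝ)) / S.σ i)

/-- `∑ j, L_ij P_ij`, where `P_ij` is the orthogonal projector on `Ker(f_ij)^⊥`. -/
def sumLP (i : Fin n) : Module.End ℝ (EuclideanSpace ℝ (Fin d)) :=
  ∑ j, (S.L i j : ℝ) • ((kerHess (S.f i j))ᗮ.starProjection : EuclideanSpace ℝ (Fin d) →ₗ[ℝ] _)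

/-- The diagonal of the matrix `D_M`. -/
def DM (i : Fin n) : ℝ := S.σ i + lamMax (S.sumLP i)

/-- `λ_max(A_commᵀ Σ_comm A_comm)`, with `Σ_comm = Diag(1 / σ_i)`. -/
def lamMaxSig : ℝ :=
  lamMax ((Acomm S.G S.μ)ᵀ * Matrix.diagonal (fun i => (S.σ i)⁻¹) * Acomm S.G S.μ).mulVecLin

/-- `λ_min⁺(A_commᵀ D_M⁻¹ A_comm)`. -/
def lamMinDM : ℝ :=
  lamMinPos ((Acomm S.G S.μ)ᵀ * Matrix.diagonal (fun i => (S.DM i)⁻¹) * Acomm S.G S.μ).mulVecLin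

/-- The communication condition number. -/
def κcomm : ℝ := S.γ * S.lamMaxSig / S.lamMinDM

/-- The probability of a communication step. -/
def pcomm : ℝ := (1 + S.γ * ((m + S.κs) / S.κcomm))⁻¹

/-- `p_ij`, proportional in `j` to `(1 - p_comm) (1 + L_ij / σ_i)`, with
`∑ j, p_ij = 1 - p_comm`. -/
def p (i : Fin n) (j : Fin m) : ℝ :=
  (1 - S.pcomm) * (1 + S.L i j / S.σ i) / ∑ k, (1 + S.L i k / S.σ i)

/-- The parameter `α`. -/
def α : ℝ := 2 * S.lamMinDM

/-- The step-size `η`. -/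
def η : ℝ :=
  min (S.pcomm / S.lamMaxSig)
    (⨅ ij : Fin n × Fin m, S.p ij.1 ij.2 / (S.α * (1 + S.L ij.1 ij.2 / S.σ ij.1)))

/-- The state of the algorithm: the local parameters `θ^(i)` and the virtual parameters `z^(ij)`. -/
structure State (n m d : ℕ) where
  θ : Fin n → EuclideanSpace ℝ (Fin d)
  z : Fin n → Fin m → EuclideanSpace ℝ (Fin d)

/-- Initialization at an arbitrary `z₀`. -/
def init (z₀ : Fin n → Fin m → EuclideanSpace ℝ (Fin d)) : State n m d where
  θ i := -((S.σ i)⁻¹ • ∑ j, ∇ (S.f i j) (z₀ i j))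
  z := z₀

/-- Communication step: `θ ← θ - (η / p_comm) Σ W θ`. -/
def commStep (s : State n m d) : State n m d where
  θ i := s.θ i - (S.η / S.pcomm) • (S.σ i)⁻¹ • ∑ k, S.W i k • s.θ k
  z := s.z

/-- The new virtual parameters in a computation step where node `i` samples index `J i`. -/
def zNew (s : State n m d) (J : Fin n → Fin m) (i : Fin n) (j : Fin m) :
    EuclideanSpace ℝ (Fin d) :=
  if j = J i then
    (1 - S.α * S.η / S.p i j) • s.z i j + (S.α * S.η / S.p i j) • s.θ i
  else s.z i j

/-- Computation step. -/
def compStep (s : State n m d) (J : Fin n → Fin m) : State n m d where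
  θ i := s.θ i - (S.σ i)⁻¹ •
    (∇ (S.f i (J i)) (S.zNew s J i (J i)) - ∇ (S.f i (J i)) (s.z i (J i)))
  z := S.zNew s J

/-- One iteration, with the random sample `r = (u, J)`: `u` decides the kind of update and `J i` is
the index sampled by node `i` (used in computation steps only). -/
def step (s : State n m d) (r : ℝ × (Fin n → Fin m)) : State n m d :=
  if r.1 ≤ S.pcomm then S.commStep s else S.compStep s r.2

/-- The iterates of DVR started at `z₀`, driven by the samples `r 0, r 1, …`. -/
def iter (z₀ : Fin n → Fin m → EuclideanSpace ℝ (Fin d)) (r : ℕ → ℝ × (Fin n → Fin m)) :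
    ℕ → State n m d
  | 0 => S.init z₀
  | t + 1 => S.step (iter z₀ r t) (r t)

/-- The law of the sample of one iteration: `u` is uniform on `[0, 1]` and, independently, each node
`i` independently samples `j` with probability `p_ij / (1 - p_comm)`, so that a given iteration is a
computation step in which node `i` samples `j` with probability `p_ij`. -/
def sampleLaw : Measure (ℝ × (Fin n → Fin m)) :=
  (volume.restrict (Set.Icc (0 : ℝ) 1)).prod
    (Measure.pi fun i => ∑ j, ENNReal.ofReal (S.p i j / (1 - S.pcomm)) • Measure.dirac j)

/-- The primal error `∑ i, ½ ‖θ^(i) - θ⋆‖²`. -/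
def State.err (s : State n m d) (θs : EuclideanSpace ℝ (Fin d)) : ℝ :=
  ∑ i, 1 / 2 * ‖s.θ i - θs‖ ^ 2

/-- The time taken by the first `K` iterations: a communication step takes time `τ`, a computation
step (one stochastic gradient per node, in parallel) takes time `1`. -/
def time (τ : ℝ) (r : ℕ → ℝ × (Fin n → Fin m)) (K : ℕ) : ℝ :=
  ∑ t ∈ Finset.range K, if (r t).1 ≤ S.pcomm then τ else 1

end Problem

end DVR

end

/-!
DVR is block coordinate descent, in Bregman geometry, on a dual of the problem. Write
`e_i = θ_i - θ⋆`, `h_ij = ∇f_ij(z_ij) - ∇f_ij(θ⋆)`, `A = A_comm`, and let `ω` be a potential on the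
nodes, with optimal value `ω⋆`, such that `Aᵀ ω` are the dual variables of the communication edges.
The iterates satisfy `σ_i θ_i + ∑ j, ∇f_ij(z_ij) = -(W ω)_i` (`Problem.Consistent`) once `ω` makes
the gradient step `ω ← ω + (η / p_comm) θ` in each communication step. All dual Bregman
divergences can be written with primal quantities, so that no convex conjugate is needed, and the
Lyapunov function (`Problem.energy`) is

`U = λ ‖Aᵀ (ω - ω⋆)‖² + T / 2 + H`, `T = ∑ i, σ_i ‖e_i‖²`, `H = ∑ i j, ⟪z_ij - θ⋆, h_ij⟫`,

with `λ = λ_min⁺(Aᵀ D_M⁻¹ A) = α / 2`.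

* In a communication step the first-order change of `U` is governed by
  `⟪e, W (ω - ω⋆)⟫ = -T - ∑ ⟪e_i, h_ij⟫`, and the second-order terms cost at most `λ η T / 2` in
  expectation because `λ ≤ λ_max(Aᵀ Σ A)` and `(η / p_comm) λ_max(Aᵀ Σ A) ≤ 1` (`Problem.energy_commAug_le`).
* In a computation step in which node `i` samples `j`, its contribution to `U` changes by at most
  `-(α η / p_ij) ⟪z_ij - θ_i, h_ij⟫`; this is where the cocoercivity of the gradients and
  `α η (1 + L_ij / σ_i) ≤ p_ij` are used (`node_energy_sub_le`, `Problem.energy_compAug_le`).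
* In expectation the cross terms `⟪e_i, h_ij⟫` combine and `U` changes by at most
  `-λ η (3 T / 2 + 2 H)`. This is at most `-λ η U`, that is `-(α η / 2) U`, because
  `λ ‖Aᵀ (ω - ω⋆)‖² ≤ T + H` (`Problem.lamMinDM_mul_le`): `Aᵀ (ω - ω⋆)` is orthogonal to the kernel of
  `Aᵀ D_M⁻¹ A`, the vector `A Aᵀ (ω - ω⋆)` has components `-(σ_i e_i + ∑ j, h_ij)`, and
  `h_ij` lies in the range of `P_ij`.

Iterating gives the linear rate (`Problem.integral_energy_le`), and the error is at most a constant
times `U`. For the time, `p_comm` is such that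
`p_comm τ + (1 - p_comm) ≤ α η (m + κ_s + τ κ_comm / γ)` (`Problem.expected_step_time_le`), while
`O(log ε⁻¹ / (α η))` iterations suffice.
-/

noncomputable section

/-! ### Gradients of smooth convex functions -/

namespace DVR

section SmoothConvex

variable {E : Type*} [NormedAddCommGroup E] [InnerProductSpace ℝ E] [CompleteSpace E]
  {f : E → ℝ} {L : NNReal}

theorem hasDerivAt_comp_line (hd : Differentiable ℝ f) (x v : E) (t : ℝ) :
    HasDerivAt (fun s : ℝ => f (x + s • v)) (inner ℝ (∇ f (x + t • v)) v) t := by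
  have h1 : HasDerivAt (fun r : ℝ => x + r • v) v t := by
    simpa using ((hasDerivAt_id t).smul_const v).const_add x
  have h2 := (hd (x + t • v)).hasFDerivAt.comp_hasDerivAt t h1
  rw [inner_gradient_left]
  exact h2

theorem gradient_inequality (hc : ConvexOn ℝ Set.univ f) (hd : Differentiable ℝ f) (x y : E) :
    f x + inner ℝ (∇ f x) (y - x) ≤ f y := by
  have hline : ConvexOn ℝ Set.univ (fun s : ℝ => f (x + s • (y - x))) := by
    refine ⟨convex_univ, fun a _ b _ s t hs ht hst => ?_⟩
    have h := hc.2 (Set.mem_univ (x + a • (y - x))) (Set.mem_univ (x + b • (y - x))) hs ht hst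
    convert h using 2
    simp only [smul_add, smul_smul, smul_eq_mul, add_smul]
    rw [add_add_add_comm, ← add_smul s t x, hst, one_smul]
  have h := hline.le_slope_of_hasDerivAt (Set.mem_univ (0 : ℝ)) (Set.mem_univ (1 : ℝ))
    zero_lt_one (hasDerivAt_comp_line hd x (y - x) 0)
  simp only [slope_def_field, zero_smul, one_smul, add_zero, add_sub_cancel, sub_zero,
    div_one] at h
  linarith

/-- The descent lemma: an `L`-smooth function lies below its quadratic upper models. -/
theorem le_quadratic_upper_bound (hd : Differentiable ℝ f) (hL : LipschitzWith L (∇ f))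
    (x y : E) :
    f y ≤ f x + inner ℝ (∇ f x) (y - x) + L / 2 * ‖y - x‖ ^ 2 := by
  set v := y - x with hv
  let g : ℝ → ℝ := fun s => f (x + s • v) - s * inner ℝ (∇ f x) v - L / 2 * s ^ 2 * ‖v‖ ^ 2
  have hg : ∀ t, HasDerivAt g
      (inner ℝ (∇ f (x + t • v)) v - inner ℝ (∇ f x) v - L * t * ‖v‖ ^ 2) t := by
    intro t
    have h1 := ((hasDerivAt_comp_line hd x v t).sub
      ((hasDerivAt_id t).mul_const (inner ℝ (∇ f x) v))).sub
      ((((hasDerivAt_id t).pow 2).const_mul (L / 2 : ℝ)).mul_const (‖v‖ ^ 2))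
    refine h1.congr_deriv ?_
    simp only [id, Nat.cast_ofNat]
    ring
  have hanti : AntitoneOn g (Set.Ici 0) := by
    refine antitoneOn_of_deriv_nonpos (convex_Ici 0)
      (fun t _ => (hg t).continuousAt.continuousWithinAt)
      (fun t _ => (hg t).differentiableAt.differentiableWithinAt) fun t ht => ?_
    rw [interior_Ici, Set.mem_Ioi] at ht
    rw [(hg t).deriv, ← inner_sub_left]
    have h1 := real_inner_le_norm (∇ f (x + t • v) - ∇ f x) v
    have h2 := hL.norm_sub_le (x + t • v) x
    rw [add_sub_cancel_left, norm_smul, Real.norm_of_nonneg ht.le] at h2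
    nlinarith [mul_le_mul_of_nonneg_right h2 (norm_nonneg v)]
  have h := hanti (Set.mem_Ici.2 le_rfl) (Set.mem_Ici.2 zero_le_one) zero_le_one
  simp only [g, hv] at h
  simp only [zero_smul, one_smul, add_zero, add_sub_cancel] at h
  linarith

/-- A convex `L`-smooth function exceeds its tangent at `y` by at least `‖∇f x - ∇f y‖² / 2L`. -/
theorem sq_norm_gradient_sub_le (hc : ConvexOn ℝ Set.univ f) (hd : Differentiable ℝ f)
    (hL : LipschitzWith L (∇ f)) (x y : E) :
    ‖∇ f x - ∇ f y‖ ^ 2 ≤ 2 * L * (f x - f y - inner ℝ (∇ f y) (x - y)) := by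
  rcases eq_or_lt_of_le (NNReal.coe_nonneg L) with h0 | h0
  · have h := hL.norm_sub_le x y
    rw [← h0, zero_mul] at h
    rw [← h0, le_antisymm h (norm_nonneg _)]
    simp
  · -- compare the tangent at `y` and the quadratic model at `x` at the point `x - L⁻¹ (∇f x - ∇f y)`
    set a := ∇ f x - ∇ f y with ha
    have h1 := gradient_inequality hc hd y (x - (L : ℝ)⁻¹ • a)
    have h2 := le_quadratic_upper_bound hd hL x (x - (L : ℝ)⁻¹ • a)
    have e1 : x - (L : ℝ)⁻¹ • a - y = (x - y) - (L : ℝ)⁻¹ • a := by abel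
    have e2 : x - (L : ℝ)⁻¹ • a - x = -((L : ℝ)⁻¹ • a) := by abel
    have e3 : inner ℝ (∇ f x) a - inner ℝ (∇ f y) a = ‖a‖ ^ 2 := by
      rw [← inner_sub_left, ← ha, real_inner_self_eq_norm_sq]
    rw [e1, inner_sub_right, inner_smul_right] at h1
    rw [e2, inner_neg_right, inner_smul_right, norm_neg, norm_smul, mul_pow, norm_inv,
      Real.norm_of_nonneg h0.le] at h2
    have h3 : (L : ℝ)⁻¹ / 2 * ‖a‖ ^ 2 ≤ f x - f y - inner ℝ (∇ f y) (x - y) := by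
      have e4 : (L : ℝ) / 2 * ((L : ℝ)⁻¹ ^ 2 * ‖a‖ ^ 2) = (L : ℝ)⁻¹ / 2 * ‖a‖ ^ 2 := by
        field_simp
      rw [e4] at h2
      have e5 : (L : ℝ)⁻¹ * inner ℝ (∇ f x) a - (L : ℝ)⁻¹ * inner ℝ (∇ f y) a
          = (L : ℝ)⁻¹ * ‖a‖ ^ 2 := by rw [← mul_sub, e3]
      linarith
    calc ‖a‖ ^ 2 = 2 * L * ((L : ℝ)⁻¹ / 2 * ‖a‖ ^ 2) := by field_simp
      _ ≤ _ := by gcongr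

/-- The gradient of a convex `L`-smooth function is `L⁻¹`-cocoercive (Baillon–Haddad). -/
theorem cocoercive (hc : ConvexOn ℝ Set.univ f) (hd : Differentiable ℝ f)
    (hL : LipschitzWith L (∇ f)) (x y : E) :
    ‖∇ f x - ∇ f y‖ ^ 2 ≤ L * inner ℝ (x - y) (∇ f x - ∇ f y) := by
  have h1 := sq_norm_gradient_sub_le hc hd hL x y
  have h2 := sq_norm_gradient_sub_le hc hd hL y x
  have e : inner ℝ (x - y) (∇ f x - ∇ f y) =
      -inner ℝ (∇ f x) (y - x) - inner ℝ (∇ f y) (x - y) := by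
    rw [real_inner_comm, inner_sub_left, ← neg_sub x y, inner_neg_right]
    ring
  rw [norm_sub_rev] at h2
  rw [e]
  linarith

theorem monotone_gradient (hc : ConvexOn ℝ Set.univ f) (hd : Differentiable ℝ f) (x y : E) :
    0 ≤ inner ℝ (x - y) (∇ f x - ∇ f y) := by
  have h1 := gradient_inequality hc hd x y
  have h2 := gradient_inequality hc hd y x
  have e : inner ℝ (x - y) (∇ f x - ∇ f y) =
      -inner ℝ (∇ f x) (y - x) - inner ℝ (∇ f y) (x - y) := by
    rw [real_inner_comm, inner_sub_left, ← neg_sub x y, inner_neg_right]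
    ring
  linarith

/-- Variations of the gradient are orthogonal to the directions along which it is constant:
moving `x` arbitrarily far along such a direction must preserve monotonicity of the gradient. -/
theorem gradient_sub_mem_kerHess_orthogonal (hc : ConvexOn ℝ Set.univ f)
    (hd : Differentiable ℝ f) (x y : E) : ∇ f x - ∇ f y ∈ (kerHess f)ᗮ := by
  rw [Submodule.mem_orthogonal]
  intro v hv
  set b := inner ℝ v (∇ f x - ∇ f y)
  set a := inner ℝ (x - y) (∇ f x - ∇ f y)
  have key : ∀ s : ℝ, 0 ≤ a + s * b := by
    intro s
    have h := monotone_gradient hc hd (x + s • v) y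
    rw [show ∇ f (x + s • v) = ∇ f x from hv x s, add_sub_right_comm, inner_add_left,
      inner_smul_left] at h
    simpa using h
  by_contra hb
  have h := key (-(a + 1) / b)
  rw [div_mul_cancel₀ _ hb] at h
  linarith

end SmoothConvex

end DVR

/-! ### Extreme eigenvalues of symmetric operators and Gram matrices -/

namespace DVR

section Spectral

variable {V : Type*} [NormedAddCommGroup V] [InnerProductSpace ℝ V] [FiniteDimensional ℝ V]
  {T : Module.End ℝ V}

theorem le_lamMax {x : ℝ} (hx : T.HasEigenvalue x) : x ≤ lamMax T :=
  le_csSup T.finite_hasEigenvalue.bddAbove hx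

theorem lamMinPos_le {x : ℝ} (hx : T.HasEigenvalue x) (h0 : x ≠ 0) : lamMinPos T ≤ x :=
  csInf_le (T.finite_hasEigenvalue.subset fun _ h => h.1).bddBelow ⟨hx, h0⟩

theorem inner_apply_self_eq_sum (hT : T.IsSymmetric) (x : V) :
    inner ℝ (T x) x =
      ∑ k, hT.eigenvalues rfl k * (inner ℝ (hT.eigenvectorBasis rfl k) x) ^ 2 := by
  rw [← (hT.eigenvectorBasis rfl).sum_inner_mul_inner (T x) x]
  refine Finset.sum_congr rfl fun k _ => ?_
  rw [hT, hT.apply_eigenvectorBasis rfl k, RCLike.ofReal_real_eq_id, id, inner_smul_right,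
    real_inner_comm]
  ring

theorem norm_sq_eq_sum_eigenvectorBasis (hT : T.IsSymmetric) (x : V) :
    ‖x‖ ^ 2 = ∑ k, (inner ℝ (hT.eigenvectorBasis rfl k) x) ^ 2 := by
  rw [← (hT.eigenvectorBasis rfl).sum_sq_norm_inner_right x]
  exact Finset.sum_congr rfl fun k _ => by rw [Real.norm_eq_abs, sq_abs]

theorem inner_apply_self_le_lamMax (hT : T.IsSymmetric) (x : V) :
    inner ℝ (T x) x ≤ lamMax T * ‖x‖ ^ 2 := by
  rw [inner_apply_self_eq_sum hT, norm_sq_eq_sum_eigenvectorBasis hT, Finset.mul_sum]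
  gcongr with k
  exact le_lamMax (hT.hasEigenvalue_eigenvalues rfl k)

theorem lamMinPos_le_inner_apply_self (hT : T.IsSymmetric) {x : V}
    (hx : ∀ v, T v = 0 → inner ℝ v x = 0) :
    lamMinPos T * ‖x‖ ^ 2 ≤ inner ℝ (T x) x := by
  rw [inner_apply_self_eq_sum hT, norm_sq_eq_sum_eigenvectorBasis hT, Finset.mul_sum]
  refine Finset.sum_le_sum fun k _ => ?_
  by_cases h0 : hT.eigenvalues rfl k = 0
  · rw [hx (hT.eigenvectorBasis rfl k) (by rw [hT.apply_eigenvectorBasis rfl k, h0]; simp)]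
    simp
  · gcongr
    exact lamMinPos_le (hT.hasEigenvalue_eigenvalues rfl k) h0

omit [FiniteDimensional ℝ V] in
theorem hasEigenvalue_nonneg (hpos : ∀ x, 0 ≤ inner ℝ (T x) x) {μ : ℝ}
    (hμ : T.HasEigenvalue μ) : 0 ≤ μ := by
  obtain ⟨v, hv⟩ := hμ.exists_hasEigenvector
  have h := hpos v
  rw [hv.apply_eq_smul, inner_smul_left, real_inner_self_eq_norm_sq] at h
  exact nonneg_of_mul_nonneg_left h (by have := norm_pos_iff.2 hv.2; positivity)

omit [FiniteDimensional ℝ V] in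
theorem lamMax_nonneg (hpos : ∀ x, 0 ≤ inner ℝ (T x) x) : 0 ≤ lamMax T :=
  Real.sSup_nonneg fun _ h => hasEigenvalue_nonneg hpos h

theorem lamMax_pos (hT : T.IsSymmetric) {x : V} (hx : 0 < inner ℝ (T x) x) : 0 < lamMax T :=
  pos_of_mul_pos_left (hx.trans_le (inner_apply_self_le_lamMax hT x)) (by positivity)

theorem lamMinPos_pos (hT : T.IsSymmetric) (hpos : ∀ x, 0 ≤ inner ℝ (T x) x) {x : V}
    (hx : 0 < inner ℝ (T x) x) : 0 < lamMinPos T := by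
  have hne : {y : ℝ | T.HasEigenvalue y ∧ y ≠ 0}.Nonempty := by
    by_contra h
    rw [inner_apply_self_eq_sum hT] at hx
    refine hx.ne' (Finset.sum_eq_zero fun k _ => ?_)
    have : hT.eigenvalues rfl k = 0 := by
      by_contra hk
      exact h ⟨_, hT.hasEigenvalue_eigenvalues rfl k, hk⟩
    rw [this, zero_mul]
  have h := hne.csInf_mem (T.finite_hasEigenvalue.subset fun _ h => h.1)
  exact lt_of_le_of_ne (hasEigenvalue_nonneg hpos h.1) (Ne.symm h.2)

end Spectral

section WeightedGram

theorem hasEigenvalue_toEuclideanLin_iff {ι : Type*} [Fintype ι] [DecidableEq ι]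
    (Q : Matrix ι ι ℝ) (x : ℝ) :
    (Module.End.HasEigenvalue (Matrix.toEuclideanLin Q) x) ↔
      Module.End.HasEigenvalue Q.mulVecLin x := by
  constructor
  · intro h
    obtain ⟨v, hv⟩ := h.exists_hasEigenvector
    refine Module.End.hasEigenvalue_of_hasEigenvector (x := v.ofLp)
      (Module.End.hasEigenvector_iff.2 ⟨Module.End.mem_eigenspace_iff.2 ?_, ?_⟩)
    · exact congrArg WithLp.ofLp hv.apply_eq_smul
    · exact fun h0 => hv.2 (WithLp.ofLp_injective 2 h0)
  · intro h
    obtain ⟨v, hv⟩ := h.exists_hasEigenvector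
    refine Module.End.hasEigenvalue_of_hasEigenvector (x := WithLp.toLp 2 v)
      (Module.End.hasEigenvector_iff.2 ⟨Module.End.mem_eigenspace_iff.2 ?_, ?_⟩)
    · exact congrArg (WithLp.toLp 2) hv.apply_eq_smul
    · exact fun h0 => hv.2 (WithLp.toLp_injective 2 h0)

theorem lamMax_toEuclideanLin {ι : Type*} [Fintype ι] [DecidableEq ι] (Q : Matrix ι ι ℝ) :
    lamMax (Matrix.toEuclideanLin Q) = lamMax Q.mulVecLin := by
  simp only [lamMax, hasEigenvalue_toEuclideanLin_iff]

theorem lamMinPos_toEuclideanLin {ι : Type*} [Fintype ι] [DecidableEq ι] (Q : Matrix ι ι ℝ) :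
    lamMinPos (Matrix.toEuclideanLin Q) = lamMinPos Q.mulVecLin := by
  simp only [lamMinPos, hasEigenvalue_toEuclideanLin_iff]

variable {ι κ : Type*} [Fintype ι] [DecidableEq ι] [Fintype κ] [DecidableEq κ]

/-- The matrix `Bᵀ Diag(c) B` of the quadratic form `y ↦ ∑ i, c_i (B y)_i²`. -/
def weightedGram (B : Matrix ι κ ℝ) (c : ι → ℝ) : Matrix κ κ ℝ := Bᵀ * Matrix.diagonal c * B

theorem isSymmetric_weightedGram (B : Matrix ι κ ℝ) (c : ι → ℝ) :
    (Matrix.toEuclideanLin (weightedGram B c)).IsSymmetric := by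
  rw [Matrix.isSymmetric_toEuclideanLin_iff, weightedGram, Matrix.IsHermitian,
    Matrix.conjTranspose_eq_transpose_of_trivial]
  simp [Matrix.transpose_mul, Matrix.mul_assoc]

theorem inner_weightedGram (B : Matrix ι κ ℝ) (c : ι → ℝ) (y : EuclideanSpace ℝ κ) :
    inner ℝ (Matrix.toEuclideanLin (weightedGram B c) y) y = ∑ i, c i * (B *ᵥ y) i ^ 2 := by
  rw [EuclideanSpace.inner_eq_star_dotProduct, star_trivial, Matrix.ofLp_toLpLin,
    Matrix.toLin'_apply, weightedGram, ← Matrix.mulVec_mulVec, ← Matrix.mulVec_mulVec,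
    Matrix.dotProduct_mulVec, Matrix.vecMul_transpose, dotProduct]
  refine Finset.sum_congr rfl fun i _ => ?_
  rw [Matrix.mulVec_diagonal]
  ring

theorem sum_sq_mulVec_le (B : Matrix ι κ ℝ) (c : ι → ℝ) (y : κ → ℝ) :
    ∑ i, c i * (B *ᵥ y) i ^ 2 ≤ lamMax (weightedGram B c).mulVecLin * ∑ e, y e ^ 2 := by
  have h := inner_apply_self_le_lamMax (isSymmetric_weightedGram B c) (WithLp.toLp 2 y)
  rwa [inner_weightedGram, lamMax_toEuclideanLin, EuclideanSpace.real_norm_sq_eq] at h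

theorem mulVec_eq_zero_of_weightedGram {B : Matrix ι κ ℝ} {c : ι → ℝ} (hc : ∀ i, 0 < c i)
    {y : EuclideanSpace ℝ κ} (hy : Matrix.toEuclideanLin (weightedGram B c) y = 0) :
    B *ᵥ y = 0 := by
  have h := inner_weightedGram B c y
  rw [hy, inner_zero_left, eq_comm, Finset.sum_eq_zero_iff_of_nonneg
    fun i _ => mul_nonneg (hc i).le (sq_nonneg _)] at h
  ext i
  simpa [(hc i).ne'] using h i (Finset.mem_univ i)

theorem le_sum_sq_mulVec_transpose (B : Matrix ι κ ℝ) {c : ι → ℝ} (hc : ∀ i, 0 < c i)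
    (u : ι → ℝ) :
    lamMinPos (weightedGram B c).mulVecLin * ∑ e, (Bᵀ *ᵥ u) e ^ 2 ≤
      ∑ i, c i * (B *ᵥ (Bᵀ *ᵥ u)) i ^ 2 := by
  have h := lamMinPos_le_inner_apply_self (isSymmetric_weightedGram B c)
    (x := WithLp.toLp 2 (Bᵀ *ᵥ u)) fun v hv => by
      rw [EuclideanSpace.inner_eq_star_dotProduct, star_trivial, dotProduct_comm,
        Matrix.dotProduct_mulVec, Matrix.vecMul_transpose,
        mulVec_eq_zero_of_weightedGram hc hv, zero_dotProduct]
  rwa [inner_weightedGram, lamMinPos_toEuclideanLin, EuclideanSpace.real_norm_sq_eq] at h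

theorem exists_inner_weightedGram_pos {B : Matrix ι κ ℝ} (hB : B ≠ 0) {c : ι → ℝ}
    (hc : ∀ i, 0 < c i) :
    ∃ y, 0 < inner ℝ (Matrix.toEuclideanLin (weightedGram B c) y) y := by
  by_contra! h
  refine hB (Matrix.ext_of_mulVec_single fun k => ?_)
  have h1 := h (WithLp.toLp 2 (Pi.single k 1))
  rw [inner_weightedGram] at h1
  have h2 := (Finset.sum_eq_zero_iff_of_nonneg
    fun i _ => mul_nonneg (hc i).le (sq_nonneg _)).1
    (le_antisymm h1 (Finset.sum_nonneg fun i _ => mul_nonneg (hc i).le (sq_nonneg _)))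
  ext i
  simpa [(hc i).ne'] using h2 i (Finset.mem_univ i)

theorem inner_weightedGram_nonneg (B : Matrix ι κ ℝ) {c : ι → ℝ} (hc : ∀ i, 0 < c i)
    (y : EuclideanSpace ℝ κ) :
    0 ≤ inner ℝ (Matrix.toEuclideanLin (weightedGram B c) y) y := by
  rw [inner_weightedGram]
  exact Finset.sum_nonneg fun i _ => mul_nonneg (hc i).le (sq_nonneg _)

theorem lamMax_weightedGram_pos {B : Matrix ι κ ℝ} (hB : B ≠ 0) {c : ι → ℝ}
    (hc : ∀ i, 0 < c i) : 0 < lamMax (weightedGram B c).mulVecLin := by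
  obtain ⟨y, hy⟩ := exists_inner_weightedGram_pos hB hc
  rw [← lamMax_toEuclideanLin]
  exact lamMax_pos (isSymmetric_weightedGram B c) hy

theorem lamMinPos_weightedGram_pos {B : Matrix ι κ ℝ} (hB : B ≠ 0) {c : ι → ℝ}
    (hc : ∀ i, 0 < c i) : 0 < lamMinPos (weightedGram B c).mulVecLin := by
  obtain ⟨y, hy⟩ := exists_inner_weightedGram_pos hB hc
  rw [← lamMinPos_toEuclideanLin]
  exact lamMinPos_pos (isSymmetric_weightedGram B c) (inner_weightedGram_nonneg B hc) hy

/-- `B` and `Bᵀ` give the same upper bound: `Bᵀ Diag(c) B` and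
`Diag(c)^½ B Bᵀ Diag(c)^½` have the same non-zero eigenvalues. -/
theorem sum_sq_transpose_mulVec_le {B : Matrix ι κ ℝ} {c : ι → ℝ} (hc : ∀ i, 0 < c i)
    (u : ι → ℝ) :
    ∑ e, (Bᵀ *ᵥ u) e ^ 2 ≤
      lamMax (weightedGram B c).mulVecLin * ∑ i, (c i)⁻¹ * u i ^ 2 := by
  set Λ := lamMax (weightedGram B c).mulVecLin
  set N := ∑ e, (Bᵀ *ᵥ u) e ^ 2 with hN
  set t := ∑ i, (c i)⁻¹ * u i ^ 2
  have hN0 : 0 ≤ N := Finset.sum_nonneg fun _ _ => sq_nonneg _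
  have h1 : N = ∑ i, u i * (B *ᵥ (Bᵀ *ᵥ u)) i := by
    have : N = (Bᵀ *ᵥ u) ⬝ᵥ (Bᵀ *ᵥ u) := by
      simp only [hN, dotProduct, sq]
    rw [this, Matrix.dotProduct_mulVec, Matrix.vecMul_transpose, dotProduct_comm, dotProduct]
  have h2 := sum_sq_mulVec_le B c (Bᵀ *ᵥ u)
  have h3 : N ^ 2 ≤ t * ∑ i, c i * (B *ᵥ (Bᵀ *ᵥ u)) i ^ 2 := by
    rw [h1]
    refine Finset.sum_sq_le_sum_mul_sum_of_sq_le_mul _ (fun i _ => ?_) (fun i _ => ?_)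
      (fun i _ => ?_)
    · have := hc i; positivity
    · have := hc i; positivity
    · have := (hc i).ne'; exact le_of_eq (by field_simp)
  have ht : 0 ≤ t := Finset.sum_nonneg fun i _ => by have := hc i; positivity
  rcases eq_or_lt_of_le hN0 with h0 | h0
  · rw [← h0]
    refine mul_nonneg ?_ ht
    rw [show Λ = _ from (lamMax_toEuclideanLin _).symm]
    exact lamMax_nonneg (inner_weightedGram_nonneg B hc)
  · have h4 : N * N ≤ (Λ * t) * N := by nlinarith [mul_le_mul_of_nonneg_left h2 ht]
    exact le_of_mul_le_mul_right h4 h0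

end WeightedGram

end DVR

/-! ### Expectations along random iterations -/

namespace DVR

section RandomIteration

variable {X J : Type*} [Finite J] [MeasurableSpace J] [MeasurableSingletonClass J]

/-- The random iteration on an arbitrary state space `X` in which a sample `(u, j)` applies the map
`c` if `u ≤ q` and the map `k · j` otherwise. -/
def randIter (q : ℝ) (c : X → X) (k : X → J → X) (x₀ : X) (r : ℕ → ℝ × J) : ℕ → X
  | 0 => x₀
  | t + 1 => if (r t).1 ≤ q then c (randIter q c k x₀ r t) else k (randIter q c k x₀ r t) (r t).2

variable (q : ℝ) (c : X → X) (k : X → J → X) (x₀ : X)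

/-- No measurable structure on `X` is needed: only finitely many states can be reached in `t`
steps, so that every real function of the state is a bounded measurable function of the first `t`
samples. -/
theorem exists_measurable_eq_randIter (t : ℕ) (Φ : X → ℝ) :
    ∃ G : (Finset.range t → ℝ × J) → ℝ, Measurable G ∧ (∃ C, ∀ h, |G h| ≤ C) ∧
      ∀ r : ℕ → ℝ × J, Φ (randIter q c k x₀ r t) = G fun i => r i := by
  classical
  have := Fintype.ofFinite J
  induction t generalizing Φ with
  | zero => exact ⟨fun _ => Φ x₀, measurable_const, ⟨|Φ x₀|, fun _ => le_rfl⟩, fun _ => rfl⟩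
  | succ t ih =>
    obtain ⟨Gc, hGc, ⟨Cc, hCc⟩, hc⟩ := ih fun x => Φ (c x)
    choose Gk hGk hbk hk using fun j => ih fun x => Φ (k x j)
    choose Ck hCk using hbk
    let ρ : (Finset.range (t + 1) → ℝ × J) → (Finset.range t → ℝ × J) :=
      fun h i => h ⟨i, Finset.range_subset_range.2 (Nat.le_succ t) i.2⟩
    have hρ : Measurable ρ := measurable_pi_lambda _ fun i => measurable_pi_apply _
    let last : Finset.range (t + 1) := ⟨t, Finset.self_mem_range_succ t⟩
    have hl : Measurable fun h : Finset.range (t + 1) → ℝ × J => h last := measurable_pi_apply _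
    refine ⟨fun h => if (h last).1 ≤ q then Gc (ρ h) else
      ∑ j, if (h last).2 = j then Gk j (ρ h) else 0, ?_, ⟨max Cc (∑ j, |Ck j|), ?_⟩, ?_⟩
    · refine Measurable.ite (measurableSet_le hl.fst measurable_const) (hGc.comp hρ) ?_
      exact Finset.measurable_fun_sum _ fun j _ => Measurable.ite
        (hl.snd (measurableSet_singleton j)) ((hGk j).comp hρ) measurable_const
    · intro h
      dsimp only
      split_ifs
      · exact (hCc _).trans (le_max_left _ _)
      · refine (Finset.abs_sum_le_sum_abs _ _).trans ((Finset.sum_le_sum fun j _ => ?_).trans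
          (le_max_right _ _))
        split_ifs
        · exact (hCk j _).trans (le_abs_self _)
        · simp
    · intro r
      simp only [randIter]
      split_ifs with h1
      · exact hc r
      · rw [Finset.sum_ite_eq Finset.univ (r t).2, if_pos (Finset.mem_univ _)]
        exact hk _ r

variable {Ω : Type*} [MeasurableSpace Ω] {P : Measure Ω} [IsProbabilityMeasure P]
  {r : ℕ → Ω → ℝ × J}

theorem integrable_randIter (hr : ∀ t, Measurable (r t)) (t : ℕ) (Φ : X → ℝ) :
    Integrable (fun ω => Φ (randIter q c k x₀ (fun s => r s ω) t)) P := by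
  obtain ⟨G, hG, ⟨C, hC⟩, h⟩ := exists_measurable_eq_randIter q c k x₀ t Φ
  simp only [h]
  exact Integrable.of_bound (hG.comp (measurable_pi_lambda _ fun i => hr i)).aestronglyMeasurable
    C (.of_forall fun ω => hC _)

omit [IsProbabilityMeasure P] in
/-- A function of the state at time `t` is uncorrelated with every function of the next sample. -/
theorem integral_randIter_mul (hr : ∀ t, Measurable (r t)) (hind : iIndepFun r P)
    (t : ℕ) (Φ : X → ℝ) {g : ℝ × J → ℝ} (hg : Measurable g) :
    ∫ ω, Φ (randIter q c k x₀ (fun s => r s ω) t) * g (r t ω) ∂P =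
      (∫ ω, Φ (randIter q c k x₀ (fun s => r s ω) t) ∂P) * ∫ x, g x ∂(P.map (r t)) := by
  obtain ⟨G, hG, -, h⟩ := exists_measurable_eq_randIter q c k x₀ t Φ
  simp only [h]
  have hi := hind.indepFun_finset (Finset.range t) {t} (by simp) hr
  have hi' := hi.comp hG (hg.comp (measurable_pi_apply (⟨t, by simp⟩ : ({t} : Finset ℕ))))
  rw [integral_map (hr t).aemeasurable hg.aestronglyMeasurable]
  exact hi'.integral_fun_mul_eq_mul_integral
    (hG.comp (measurable_pi_lambda _ fun i => hr i)).aestronglyMeasurable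
    (hg.comp (hr t)).aestronglyMeasurable

theorem restrict_Icc_real_Iic {q : ℝ} (hq0 : 0 ≤ q) (hq1 : q ≤ 1) :
    (volume.restrict (Set.Icc (0 : ℝ) 1)).real (Set.Iic q) = q := by
  have : Set.Iic q ∩ Set.Icc 0 1 = Set.Icc 0 q := by
    ext x
    simp only [Set.mem_inter_iff, Set.mem_Iic, Set.mem_Icc]
    constructor
    · rintro ⟨h1, h2, -⟩; exact ⟨h2, h1⟩
    · rintro ⟨h1, h2⟩; exact ⟨h2, h1, h2.trans hq1⟩
  rw [measureReal_restrict_apply measurableSet_Iic, this, Real.volume_real_Icc_of_le hq0, sub_zero]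

theorem restrict_Icc_real_Ioi {q : ℝ} (hq0 : 0 ≤ q) (hq1 : q ≤ 1) :
    (volume.restrict (Set.Icc (0 : ℝ) 1)).real (Set.Ioi q) = 1 - q := by
  have : Set.Ioi q ∩ Set.Icc 0 1 = Set.Ioc q 1 := by
    ext x
    simp only [Set.mem_inter_iff, Set.mem_Ioi, Set.mem_Icc, Set.mem_Ioc]
    constructor
    · rintro ⟨h1, -, h2⟩; exact ⟨h1, h2⟩
    · rintro ⟨h1, h2⟩; exact ⟨h1, hq0.trans h1.le, h2⟩
  rw [measureReal_restrict_apply measurableSet_Ioi, this, Real.volume_real_Ioc_of_le hq1]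

/-- The one-step formula for the expectation of a function of the state. -/
theorem integral_randIter_succ (hr : ∀ t, Measurable (r t)) (hind : iIndepFun r P)
    {π : Measure J} [IsProbabilityMeasure π] {t : ℕ} (hq0 : 0 ≤ q) (hq1 : q ≤ 1)
    (hlaw : P.map (r t) = (volume.restrict (Set.Icc (0 : ℝ) 1)).prod π) (Φ : X → ℝ) :
    ∫ ω, Φ (randIter q c k x₀ (fun s => r s ω) (t + 1)) ∂P =
      ∫ ω, (q * Φ (c (randIter q c k x₀ (fun s => r s ω) t)) +
        (1 - q) * ∫ j, Φ (k (randIter q c k x₀ (fun s => r s ω) t) j) ∂π) ∂P := by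
  classical
  have := Fintype.ofFinite J
  let A : Set (ℝ × J) := Set.Iic q ×ˢ Set.univ
  let B : J → Set (ℝ × J) := fun j => Set.Ioi q ×ˢ {j}
  have hA : MeasurableSet A := measurableSet_Iic.prod .univ
  have hB : ∀ j, MeasurableSet (B j) := fun j => measurableSet_Ioi.prod (measurableSet_singleton j)
  let x : Ω → X := fun ω => randIter q c k x₀ (fun s => r s ω) t
  have hint : ∀ Ψ : X → ℝ, Integrable (fun ω => Ψ (x ω)) P :=
    fun Ψ => integrable_randIter q c k x₀ hr t Ψ
  have hmA : ∫ y, A.indicator 1 y ∂(P.map (r t)) = q := by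
    rw [integral_indicator_one hA, hlaw, measureReal_prod_prod, restrict_Icc_real_Iic hq0 hq1]
    simp
  have hmB : ∀ j, ∫ y, (B j).indicator 1 y ∂(P.map (r t)) = (1 - q) * π.real {j} := fun j => by
    rw [integral_indicator_one (hB j), hlaw, measureReal_prod_prod, restrict_Icc_real_Ioi hq0 hq1]
  have hbd : ∀ (Ψ : X → ℝ) {D : Set (ℝ × J)}, MeasurableSet D →
      Integrable (fun ω => Ψ (x ω) * D.indicator (1 : ℝ × J → ℝ) (r t ω)) P := by
    intro Ψ D hD
    refine (hint Ψ).mul_bdd (c := 1)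
      ((measurable_one.indicator hD).comp (hr t)).aestronglyMeasurable (.of_forall fun ω => ?_)
    by_cases h : r t ω ∈ D <;> simp [h]
  have hsplit : ∀ ω, Φ (randIter q c k x₀ (fun s => r s ω) (t + 1)) =
      Φ (c (x ω)) * A.indicator (1 : ℝ × J → ℝ) (r t ω) +
        ∑ j, Φ (k (x ω) j) * (B j).indicator (1 : ℝ × J → ℝ) (r t ω) := by
    intro ω
    by_cases h : (r t ω).1 ≤ q
    · simp [randIter, A, B, Set.indicator, h, not_lt.2 h, x]
    · simp [randIter, A, B, Set.indicator, h, not_le.1 h, x]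
  have hC := integral_randIter_mul q c k x₀ hr hind t (fun y => Φ (c y))
    (measurable_one.indicator hA)
  have hK := fun j => integral_randIter_mul q c k x₀ hr hind t (fun y => Φ (k y j))
    (measurable_one.indicator (hB j))
  simp only [hsplit]
  rw [integral_add (hbd (fun y => Φ (c y)) hA)
      (integrable_finsetSum _ fun j _ => hbd (fun y => Φ (k y j)) (hB j)),
    integral_finsetSum _ fun j _ => hbd (fun y => Φ (k y j)) (hB j), hC, hmA,
    integral_add ((hint fun y => Φ (c y)).const_mul q)
      ((hint fun y => ∫ j, Φ (k y j) ∂π).const_mul (1 - q)),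
    integral_const_mul, integral_const_mul, mul_comm q]
  congr 1
  simp only [integral_fintype (μ := π) .of_finite, smul_eq_mul]
  rw [integral_finsetSum _ fun j _ => (hint fun y => Φ (k y j)).const_mul _, Finset.mul_sum]
  refine Finset.sum_congr rfl fun j _ => ?_
  rw [hK j, hmB, integral_const_mul]
  ring

end RandomIteration

end DVR

/-! ### The network and the curvature of the losses -/

namespace DVR

section MatrixAction

variable {ι κ ρ : Type*} [Fintype ι] [Fintype κ] [Fintype ρ] {d : ℕ}

/-- The action of `M ⊗ I_d` on families of vectors of `ℝ^d`. -/
def matAct (M : Matrix ι κ ℝ) :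
    (κ → EuclideanSpace ℝ (Fin d)) →ₗ[ℝ] (ι → EuclideanSpace ℝ (Fin d)) :=
  LinearMap.pi fun i => ∑ k, M i k • LinearMap.proj k

omit [Fintype ι] in
theorem matAct_apply (M : Matrix ι κ ℝ) (x : κ → EuclideanSpace ℝ (Fin d)) (i : ι) :
    matAct M x i = ∑ k, M i k • x k := by
  simp [matAct]

omit [Fintype ι] in
theorem matAct_apply_coord (M : Matrix ι κ ℝ) (x : κ → EuclideanSpace ℝ (Fin d)) (i : ι)
    (a : Fin d) : matAct M x i a = (M *ᵥ fun k => x k a) i := by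
  simp [matAct_apply, Matrix.mulVec, dotProduct]

omit [Fintype ρ] in
theorem matAct_mul (M : Matrix ρ ι ℝ) (N : Matrix ι κ ℝ) (x : κ → EuclideanSpace ℝ (Fin d)) :
    matAct (M * N) x = matAct M (matAct N x) := by
  ext i a
  simp only [matAct_apply_coord, ← Matrix.mulVec_mulVec]

theorem sum_inner_matAct (M : Matrix ι κ ℝ) (u : ι → EuclideanSpace ℝ (Fin d))
    (y : κ → EuclideanSpace ℝ (Fin d)) :
    ∑ i, inner ℝ (u i) (matAct M y i) = ∑ k, inner ℝ (matAct Mᵀ u k) (y k) := by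
  simp only [matAct_apply, inner_sum, sum_inner, inner_smul_left, inner_smul_right,
    Matrix.transpose_apply, conj_trivial]
  exact Finset.sum_comm

omit [Fintype κ] in
theorem sum_mul_norm_sq_eq (c : ι → ℝ) (x : ι → EuclideanSpace ℝ (Fin d)) :
    ∑ i, c i * ‖x i‖ ^ 2 = ∑ a, ∑ i, c i * x i a ^ 2 := by
  simp only [EuclideanSpace.real_norm_sq_eq, Finset.mul_sum]
  exact Finset.sum_comm

omit [Fintype κ] in
theorem sum_norm_sq_eq (x : ι → EuclideanSpace ℝ (Fin d)) :
    ∑ i, ‖x i‖ ^ 2 = ∑ a, ∑ i, x i a ^ 2 := by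
  simpa using sum_mul_norm_sq_eq (fun _ => 1) x

variable [DecidableEq ι] [DecidableEq κ]

theorem sum_norm_sq_matAct_le (B : Matrix ι κ ℝ) (c : ι → ℝ)
    (y : κ → EuclideanSpace ℝ (Fin d)) :
    ∑ i, c i * ‖matAct B y i‖ ^ 2 ≤ lamMax (weightedGram B c).mulVecLin * ∑ e, ‖y e‖ ^ 2 := by
  rw [sum_mul_norm_sq_eq, sum_norm_sq_eq, Finset.mul_sum]
  refine Finset.sum_le_sum fun a _ => ?_
  simp only [matAct_apply_coord]
  exact sum_sq_mulVec_le B c _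

theorem le_sum_norm_sq_matAct_transpose (B : Matrix ι κ ℝ) {c : ι → ℝ} (hc : ∀ i, 0 < c i)
    (u : ι → EuclideanSpace ℝ (Fin d)) :
    lamMinPos (weightedGram B c).mulVecLin * ∑ e, ‖matAct Bᵀ u e‖ ^ 2 ≤
      ∑ i, c i * ‖matAct B (matAct Bᵀ u) i‖ ^ 2 := by
  rw [sum_mul_norm_sq_eq, sum_norm_sq_eq, Finset.mul_sum]
  refine Finset.sum_le_sum fun a _ => ?_
  simp only [matAct_apply_coord]
  exact le_sum_sq_mulVec_transpose B hc _

theorem sum_norm_sq_matAct_transpose_le {B : Matrix ι κ ℝ} {c : ι → ℝ} (hc : ∀ i, 0 < c i)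
    (u : ι → EuclideanSpace ℝ (Fin d)) :
    ∑ e, ‖matAct Bᵀ u e‖ ^ 2 ≤
      lamMax (weightedGram B c).mulVecLin * ∑ i, (c i)⁻¹ * ‖u i‖ ^ 2 := by
  rw [sum_mul_norm_sq_eq, sum_norm_sq_eq, Finset.mul_sum]
  refine Finset.sum_le_sum fun a _ => ?_
  simp only [matAct_apply_coord]
  exact sum_sq_transpose_mulVec_le hc _

end MatrixAction

namespace Problem

variable {n m d : ℕ} (S : Problem n m d)

section Network

theorem Acomm_ne_zero (hn : 2 ≤ n) : Acomm S.G S.μ ≠ 0 := by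
  intro h
  have hk := S.ker_gossip
  rw [gossip, h, Matrix.zero_mul, Matrix.mulVecLin_zero, LinearMap.ker_zero] at hk
  have hmem : (Pi.single ⟨0, by omega⟩ 1 : Fin n → ℝ) ∈ Submodule.span ℝ {fun _ => (1 : ℝ)} :=
    hk ▸ Submodule.mem_top
  obtain ⟨a, ha⟩ := Submodule.mem_span_singleton.1 hmem
  have h0 := congrFun ha ⟨0, by omega⟩
  have h1 := congrFun ha ⟨1, by omega⟩
  simp at h0 h1
  linarith

theorem matAct_Acomm_transpose_const (v : EuclideanSpace ℝ (Fin d)) :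
    matAct (Acomm S.G S.μ)ᵀ (fun _ => v) = 0 := by
  ext e
  simp [matAct_apply, ← Finset.sum_smul, Acomm, ← Finset.mul_sum]

theorem matAct_W (x : Fin n → EuclideanSpace ℝ (Fin d)) :
    matAct S.W x = matAct (Acomm S.G S.μ) (matAct (Acomm S.G S.μ)ᵀ x) := by
  rw [W, gossip, matAct_mul]

theorem sum_inner_matAct_W (u x : Fin n → EuclideanSpace ℝ (Fin d)) :
    ∑ i, inner ℝ (u i) (matAct S.W x i) =
      ∑ e, inner ℝ (matAct (Acomm S.G S.μ)ᵀ u e) (matAct (Acomm S.G S.μ)ᵀ x e) := by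
  rw [matAct_W, sum_inner_matAct]

/-- A vector with zero sum is in the range of the gossip matrix, the orthogonal complement of its
kernel. -/
theorem exists_W_mulVec_eq {y : Fin n → ℝ} (hy : ∑ i, y i = 0) : ∃ x, S.W *ᵥ x = y := by
  have hsymm : (Matrix.toEuclideanLin S.W).IsSymmetric := by
    rw [Matrix.isSymmetric_toEuclideanLin_iff, Matrix.IsHermitian,
      Matrix.conjTranspose_eq_transpose_of_trivial]
    simp [W, gossip, Matrix.transpose_mul]
  have hmem : WithLp.toLp 2 y ∈ LinearMap.range (Matrix.toEuclideanLin S.W) := by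
    rw [← Submodule.orthogonal_orthogonal (LinearMap.range _), hsymm.orthogonal_range,
      Submodule.mem_orthogonal]
    intro v hv
    have hv' : v.ofLp ∈ LinearMap.ker (gossip S.G S.μ).mulVecLin :=
      congrArg WithLp.ofLp (LinearMap.mem_ker.1 hv)
    rw [S.ker_gossip] at hv'
    obtain ⟨a, ha⟩ := Submodule.mem_span_singleton.1 hv'
    rw [EuclideanSpace.inner_eq_star_dotProduct, star_trivial, ← ha]
    simp [dotProduct, ← Finset.sum_mul, hy]
  obtain ⟨x, hx⟩ := hmem
  exact ⟨x.ofLp, congrArg WithLp.ofLp hx⟩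

theorem exists_matAct_W_eq {y : Fin n → EuclideanSpace ℝ (Fin d)} (hy : ∑ i, y i = 0) :
    ∃ x, matAct S.W x = y := by
  have hcoord : ∀ a : Fin d, ∃ x, S.W *ᵥ x = fun i => y i a := fun a =>
    S.exists_W_mulVec_eq (by simpa using congrArg (fun v : EuclideanSpace ℝ (Fin d) => v a) hy)
  choose x hx using hcoord
  refine ⟨fun i => WithLp.toLp 2 fun a => x a i, ?_⟩
  ext i a
  rw [matAct_apply_coord]
  exact congrFun (hx a) i

end Network

section CurvatureBound

theorem inner_sumLP (i : Fin n) (v : EuclideanSpace ℝ (Fin d)) :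
    inner ℝ (S.sumLP i v) v =
      ∑ j, (S.L i j : ℝ) * ‖(kerHess (S.f i j))ᗮ.starProjection v‖ ^ 2 := by
  simp only [sumLP, LinearMap.sum_apply, LinearMap.smul_apply, sum_inner, inner_smul_left]
  refine Finset.sum_congr rfl fun j _ => ?_
  congr 1
  exact Submodule.re_inner_starProjection_eq_normSq (𝕜 := ℝ) _ v

theorem isSymmetric_sumLP (i : Fin n) : (S.sumLP i).IsSymmetric := by
  intro v w
  simp only [sumLP, LinearMap.sum_apply, LinearMap.smul_apply, sum_inner, inner_sum,
    inner_smul_left, inner_smul_right]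
  refine Finset.sum_congr rfl fun j _ => ?_
  congr 1
  exact Submodule.starProjection_isSymmetric _ v w

theorem lamMax_sumLP_nonneg (i : Fin n) : 0 ≤ lamMax (S.sumLP i) :=
  lamMax_nonneg fun v => by rw [inner_sumLP]; positivity

theorem DM_pos (i : Fin n) : 0 < S.DM i :=
  add_pos_of_pos_of_nonneg (S.σ_pos i) (S.lamMax_sumLP_nonneg i)

theorem norm_sq_le_lamMax_sumLP (i : Fin n) {w : Fin m → EuclideanSpace ℝ (Fin d)} {b : Fin m → ℝ}
    (hw : ∀ j, w j ∈ (kerHess (S.f i j))ᗮ) (hb : ∀ j, 0 ≤ b j)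
    (hwb : ∀ j, ‖w j‖ ^ 2 ≤ S.L i j * b j) :
    ‖∑ j, w j‖ ^ 2 ≤ lamMax (S.sumLP i) * ∑ j, b j := by
  set v := ∑ j, w j with hv
  set ℓ := lamMax (S.sumLP i)
  have h1 : ‖v‖ ^ 2 =
      ∑ j, inner ℝ (w j) ((kerHess (S.f i j))ᗮ.starProjection v) := by
    rw [← real_inner_self_eq_norm_sq]
    nth_rw 1 [hv]
    rw [sum_inner]
    refine Finset.sum_congr rfl fun j _ => ?_
    rw [← Submodule.inner_starProjection_left_eq_right, Submodule.starProjection_eq_self_iff.2 (hw j)]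
  have h2 : (‖v‖ ^ 2) ^ 2 ≤ (∑ j, b j) * inner ℝ (S.sumLP i v) v := by
    rw [inner_sumLP, h1]
    refine Finset.sum_sq_le_sum_mul_sum_of_sq_le_mul _ (fun j _ => hb j)
      (fun j _ => by positivity) fun j _ => ?_
    have h3 := abs_real_inner_le_norm (w j) ((kerHess (S.f i j))ᗮ.starProjection v)
    calc _ ≤ (‖w j‖ * ‖(kerHess (S.f i j))ᗮ.starProjection v‖) ^ 2 := sq_le_sq' (by
            linarith [neg_abs_le (inner ℝ (w j) ((kerHess (S.f i j))ᗮ.starProjection v))])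
            ((le_abs_self _).trans h3)
      _ = ‖w j‖ ^ 2 * ‖(kerHess (S.f i j))ᗮ.starProjection v‖ ^ 2 := mul_pow _ _ _
      _ ≤ (S.L i j * b j) * ‖(kerHess (S.f i j))ᗮ.starProjection v‖ ^ 2 := by
            gcongr; exact hwb j
      _ = _ := by ring
  have hb' : 0 ≤ ∑ j, b j := Finset.sum_nonneg fun j _ => hb j
  have h4 : ‖v‖ ^ 2 * ‖v‖ ^ 2 ≤ (ℓ * ∑ j, b j) * ‖v‖ ^ 2 := by
    have := mul_le_mul_of_nonneg_left
      (inner_apply_self_le_lamMax (S.isSymmetric_sumLP i) v) hb'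
    calc _ = (‖v‖ ^ 2) ^ 2 := by ring
      _ ≤ _ := h2
      _ ≤ _ := this
      _ = _ := by ring
  rcases eq_or_lt_of_le (sq_nonneg ‖v‖) with h0 | h0
  · rw [← h0]
    exact mul_nonneg (S.lamMax_sumLP_nonneg i) hb'
  · exact le_of_mul_le_mul_right h4 h0

/-- The node-wise inequality `‖σ e + v‖² / (σ + ℓ) ≤ σ ‖e‖² + ‖v‖² / ℓ`, with the curvature bound
`‖v‖² ≤ ℓ b` in place of the division by `ℓ`, which may vanish. -/
theorem norm_sq_add_le {σ ℓ b : ℝ} (hσ : 0 ≤ σ) (hℓ : 0 ≤ ℓ) (hb : 0 ≤ b)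
    {e v : EuclideanSpace ℝ (Fin d)} (hv : ‖v‖ ^ 2 ≤ ℓ * b) :
    ‖σ • e + v‖ ^ 2 ≤ (σ + ℓ) * (σ * ‖e‖ ^ 2 + b) := by
  have h1 : 2 * inner ℝ e v ≤ ℓ * ‖e‖ ^ 2 + b := by
    refine (mul_le_mul_of_nonneg_left (real_inner_le_norm e v) zero_le_two).trans ?_
    refine abs_le_of_sq_le_sq' ?_ (by positivity) |>.2
    nlinarith [sq_nonneg (ℓ * ‖e‖ ^ 2 - b), mul_le_mul_of_nonneg_left hv (sq_nonneg ‖e‖)]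
  rw [norm_add_sq_real, norm_smul, mul_pow, Real.norm_of_nonneg hσ, inner_smul_left]
  simp only [conj_trivial]
  nlinarith [mul_le_mul_of_nonneg_left h1 hσ]

end CurvatureBound

end Problem

end DVR

/-! ### Parameters of the algorithm, the Lyapunov function, and communication steps -/

namespace DVR

namespace Problem

variable {n m d : ℕ} (S : Problem n m d)

section Parameters

theorem lamMaxSig_pos (hn : 2 ≤ n) : 0 < S.lamMaxSig :=
  lamMax_weightedGram_pos (S.Acomm_ne_zero hn) fun i => inv_pos.2 (S.σ_pos i)

theorem lamMinDM_pos (hn : 2 ≤ n) : 0 < S.lamMinDM :=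
  lamMinPos_weightedGram_pos (S.Acomm_ne_zero hn) fun i => inv_pos.2 (S.DM_pos i)

theorem α_pos (hn : 2 ≤ n) : 0 < S.α := mul_pos two_pos (S.lamMinDM_pos hn)

theorem lamMinDM_le_lamMaxSig (hn : 2 ≤ n) : S.lamMinDM ≤ S.lamMaxSig := by
  have hA : (Acomm S.G S.μ)ᵀ ≠ 0 := fun h => S.Acomm_ne_zero hn (Matrix.transpose_eq_zero.1 h)
  obtain ⟨u, hu⟩ : ∃ u, (Acomm S.G S.μ)ᵀ *ᵥ u ≠ 0 := by
    by_contra! h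
    exact hA (Matrix.ext_of_mulVec_single fun k => by rw [h, Matrix.zero_mulVec])
  have hpos : 0 < ∑ e, ((Acomm S.G S.μ)ᵀ *ᵥ u) e ^ 2 := by
    obtain ⟨e, he⟩ := Function.ne_iff.1 hu
    exact Finset.sum_pos' (fun _ _ => sq_nonneg _) ⟨e, Finset.mem_univ e, by
      have : ((Acomm S.G S.μ)ᵀ *ᵥ u) e ≠ 0 := he
      positivity⟩
  refine le_of_mul_le_mul_right ?_ hpos
  calc S.lamMinDM * _ ≤ _ :=
        le_sum_sq_mulVec_transpose (Acomm S.G S.μ) (fun i => inv_pos.2 (S.DM_pos i)) u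
    _ ≤ ∑ i, (S.σ i)⁻¹ * (Acomm S.G S.μ *ᵥ ((Acomm S.G S.μ)ᵀ *ᵥ u)) i ^ 2 := by
        gcongr with i
        · exact S.σ_pos i
        · exact le_add_of_nonneg_right (S.lamMax_sumLP_nonneg i)
    _ ≤ _ := sum_sq_mulVec_le _ _ _

theorem W_eq_weightedGram : S.W = weightedGram (Acomm S.G S.μ)ᵀ fun _ => 1 := by
  simp [W, gossip, weightedGram]

theorem γ_pos (hn : 2 ≤ n) : 0 < S.γ := by
  have hA : (Acomm S.G S.μ)ᵀ ≠ 0 := fun h => S.Acomm_ne_zero hn (Matrix.transpose_eq_zero.1 h)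
  rw [γ, W_eq_weightedGram]
  exact div_pos (lamMinPos_weightedGram_pos hA fun _ => one_pos)
    (lamMax_weightedGram_pos hA fun _ => one_pos)

theorem κcomm_pos (hn : 2 ≤ n) : 0 < S.κcomm :=
  div_pos (mul_pos (S.γ_pos hn) (S.lamMaxSig_pos hn)) (S.lamMinDM_pos hn)

theorem γ_div_κcomm (hn : 2 ≤ n) : S.γ / S.κcomm = S.lamMinDM / S.lamMaxSig := by
  have h1 := (S.γ_pos hn).ne'
  have h2 := (S.lamMaxSig_pos hn).ne'
  have h3 := (S.lamMinDM_pos hn).ne'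
  rw [κcomm]
  field_simp

theorem le_κs (i : Fin n) : 1 + (∑ j, (S.L i j : ℝ)) / S.σ i ≤ S.κs :=
  le_ciSup (f := fun i => 1 + (∑ j, (S.L i j : ℝ)) / S.σ i) (Set.finite_range _).bddAbove i

theorem κs_pos (hn : 2 ≤ n) : 0 < S.κs := by
  refine lt_of_lt_of_le ?_ (S.le_κs ⟨0, by omega⟩)
  have := S.σ_pos ⟨0, by omega⟩
  positivity

theorem ratio_pos (hn : 2 ≤ n) : 0 < S.γ * ((m + S.κs) / S.κcomm) := by
  have h1 := S.γ_pos hn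
  have h2 := S.κs_pos hn
  have h3 := S.κcomm_pos hn
  positivity

theorem pcomm_pos (hn : 2 ≤ n) : 0 < S.pcomm := by
  have := S.ratio_pos hn
  rw [pcomm]
  positivity

theorem one_sub_pcomm (hn : 2 ≤ n) :
    1 - S.pcomm = S.pcomm * (S.γ / S.κcomm * (m + S.κs)) := by
  have h := S.ratio_pos hn
  have : S.γ / S.κcomm * (m + S.κs) = S.γ * ((m + S.κs) / S.κcomm) := by ring
  rw [this, pcomm]
  have h' : 1 + S.γ * ((m + S.κs) / S.κcomm) ≠ 0 := by positivity
  rw [eq_comm, inv_mul_eq_div, div_eq_iff h', sub_mul, inv_mul_cancel₀ h']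
  ring

theorem pcomm_lt_one (hn : 2 ≤ n) : S.pcomm < 1 := by
  have h1 := S.one_sub_pcomm hn
  have h2 := mul_pos (S.pcomm_pos hn) (mul_pos (div_pos (S.γ_pos hn) (S.κcomm_pos hn))
    (add_pos_of_nonneg_of_pos (Nat.cast_nonneg m) (S.κs_pos hn)))
  linarith

theorem one_add_pos (i : Fin n) (j : Fin m) : 0 < 1 + S.L i j / S.σ i := by
  have := S.σ_pos i
  positivity

theorem sum_one_add_pos (i : Fin n) (hm : 1 ≤ m) : 0 < ∑ k, (1 + S.L i k / S.σ i) :=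
  Finset.sum_pos (fun k _ => S.one_add_pos i k) ⟨⟨0, hm⟩, Finset.mem_univ _⟩

theorem sum_one_add_le (i : Fin n) : ∑ k, (1 + S.L i k / S.σ i) ≤ m + S.κs := by
  have h := S.le_κs i
  rw [Finset.sum_add_distrib, ← Finset.sum_div]
  simp
  linarith

theorem p_pos (hn : 2 ≤ n) (i : Fin n) (j : Fin m) : 0 < S.p i j :=
  div_pos (mul_pos (sub_pos.2 (S.pcomm_lt_one hn)) (S.one_add_pos i j))
    (S.sum_one_add_pos i (Fin.pos j))

theorem sum_p (hm : 1 ≤ m) (i : Fin n) : ∑ j, S.p i j = 1 - S.pcomm := by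
  have := (S.sum_one_add_pos i hm).ne'
  simp only [p]
  rw [← Finset.sum_div, ← Finset.mul_sum, mul_div_assoc, div_self this, mul_one]

/-- A lower bound of the step size. By the choice of `p_comm` the computation term of the minimum
is at least `p_comm / 2 λ_max(Aᵀ Σ A)`, one half of the communication term; the left-hand side
is this number. -/
theorem le_η (hn : 2 ≤ n) (hm : 1 ≤ m) : S.pcomm * (S.γ / S.κcomm) / S.α ≤ S.η := by
  have hΛ := S.lamMaxSig_pos hn
  have hl := S.lamMinDM_pos hn
  have hp := S.pcomm_pos hn
  have hα := S.α_pos hn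
  have hq := div_pos (S.γ_pos hn) (S.κcomm_pos hn)
  have : Nonempty (Fin n × Fin m) := ⟨⟨⟨0, by omega⟩, ⟨0, hm⟩⟩⟩
  refine le_min ?_ (le_ciInf fun ij => ?_)
  · rw [S.γ_div_κcomm hn, α]
    calc _ = S.pcomm / S.lamMaxSig / 2 := by field_simp
      _ ≤ _ := half_le_self (by positivity)
  · have h1 := S.one_add_pos ij.1 ij.2
    have h2 := S.sum_one_add_pos ij.1 hm
    rw [p, S.one_sub_pcomm hn]
    calc S.pcomm * (S.γ / S.κcomm) / S.α
        = S.pcomm * (S.γ / S.κcomm * ∑ k, (1 + S.L ij.1 k / S.σ ij.1)) *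
            (1 + S.L ij.1 ij.2 / S.σ ij.1) / (∑ k, (1 + S.L ij.1 k / S.σ ij.1)) /
            (S.α * (1 + S.L ij.1 ij.2 / S.σ ij.1)) := by
          generalize (1 + (S.L ij.1 ij.2 : ℝ) / S.σ ij.1) = a at *
          generalize (∑ k, (1 + (S.L ij.1 k : ℝ) / S.σ ij.1)) = b at *
          field_simp
      _ ≤ _ := by
          gcongr
          exact S.sum_one_add_le ij.1

theorem η_pos (hn : 2 ≤ n) (hm : 1 ≤ m) : 0 < S.η :=
  lt_of_lt_of_le (div_pos (mul_pos (S.pcomm_pos hn) (div_pos (S.γ_pos hn) (S.κcomm_pos hn)))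
    (S.α_pos hn)) (S.le_η hn hm)

theorem η_div_pcomm_mul_le (hn : 2 ≤ n) : S.η / S.pcomm * S.lamMaxSig ≤ 1 := by
  have hΛ := S.lamMaxSig_pos hn
  have hp := S.pcomm_pos hn
  have h : S.η ≤ S.pcomm / S.lamMaxSig := min_le_left _ _
  rw [le_div_iff₀ hΛ] at h
  rw [div_mul_eq_mul_div, div_le_one hp]
  exact h

theorem step_mul_le (hn : 2 ≤ n) (i : Fin n) (j : Fin m) :
    S.α * S.η / S.p i j * (1 + S.L i j / S.σ i) ≤ 1 := by
  have hα := S.α_pos hn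
  have hp := S.p_pos hn i j
  have h1 := S.one_add_pos i j
  have h : S.η ≤ S.p i j / (S.α * (1 + S.L i j / S.σ i)) :=
    (min_le_right _ _).trans (ciInf_le (f := fun ij : Fin n × Fin m =>
      S.p ij.1 ij.2 / (S.α * (1 + S.L ij.1 ij.2 / S.σ ij.1))) (Set.finite_range _).bddBelow (i, j))
  rw [le_div_iff₀ (mul_pos hα h1)] at h
  rw [div_mul_eq_mul_div, div_le_one hp]
  linarith

theorem α_mul_η_le_one (hn : 2 ≤ n) (hm : 1 ≤ m) : S.α * S.η ≤ 1 := by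
  have i : Fin n := ⟨0, by omega⟩
  have j : Fin m := ⟨0, hm⟩
  have hp := S.p_pos hn i j
  have h1 := S.step_mul_le hn i j
  have h2 : 1 ≤ 1 + S.L i j / S.σ i := by
    have := S.σ_pos i
    have : 0 ≤ S.L i j / S.σ i := by positivity
    linarith
  have h3 : 0 ≤ S.α * S.η / S.p i j := by
    have := S.α_pos hn
    have := S.η_pos hn hm
    positivity
  have h4 : S.α * S.η / S.p i j ≤ 1 := by nlinarith
  rw [div_le_one hp] at h4
  refine h4.trans ?_
  have h5 := Finset.single_le_sum (f := S.p i) (fun k _ => (S.p_pos hn i k).le)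
    (Finset.mem_univ j)
  rw [S.sum_p hm] at h5
  linarith [S.pcomm_pos hn]

end Parameters

section Energy

/-- The gradient differences `∇f_ij(z) - ∇f_ij(θ⋆)`. -/
def gradDiff (θs : EuclideanSpace ℝ (Fin d)) (i : Fin n) (j : Fin m)
    (z : EuclideanSpace ℝ (Fin d)) : EuclideanSpace ℝ (Fin d) :=
  ∇ (S.f i j) z - ∇ (S.f i j) θs

/-- The relation between the parameters `θ`, `z` and a potential `ω` on the nodes, whose weighted
differences `Aᵀ ω` are the dual variables of the communication edges. Representing the latter by a
potential keeps them in the range of `Aᵀ`, where `λ_min⁺` bounds the quadratic form from below. -/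
def Consistent (x : State n m d × (Fin n → EuclideanSpace ℝ (Fin d))) : Prop :=
  ∀ i, S.σ i • x.1.θ i + ∑ j, ∇ (S.f i j) (x.1.z i j) = -matAct S.W x.2 i

/-- The Lyapunov function at the state `(θ, z)` and the edge potential `ω`. It is `α` times the
Bregman distance of the dual variables to the optimal ones, with `½ ‖·‖²` as the mirror map of the edge
variables `Aᵀ ω` and `f_ij* / α` as those of `∇f_ij(z_ij)`, plus the optimality gap of the dual
objective. The divergences of `f_ij*` from these two terms add up to the symmetric expression
`⟪z_ij - θ⋆, ∇f_ij(z_ij) - ∇f_ij(θ⋆)⟫`. -/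
def energy (θs : EuclideanSpace ℝ (Fin d)) (ωs : Fin n → EuclideanSpace ℝ (Fin d))
    (x : State n m d × (Fin n → EuclideanSpace ℝ (Fin d))) : ℝ :=
  S.lamMinDM * ∑ e, ‖matAct (Acomm S.G S.μ)ᵀ (x.2 - ωs) e‖ ^ 2 +
    1 / 2 * ∑ i, S.σ i * ‖x.1.θ i - θs‖ ^ 2 +
    ∑ i, ∑ j, inner ℝ (x.1.z i j - θs) (S.gradDiff θs i j (x.1.z i j))

/-- The communication step, with the corresponding gradient step on the edge potential. -/
def commAug (x : State n m d × (Fin n → EuclideanSpace ℝ (Fin d))) :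
    State n m d × (Fin n → EuclideanSpace ℝ (Fin d)) :=
  (S.commStep x.1, x.2 + (S.η / S.pcomm) • x.1.θ)

/-- The computation step, which leaves the edge potential unchanged. -/
def compAug (x : State n m d × (Fin n → EuclideanSpace ℝ (Fin d))) (J : Fin n → Fin m) :
    State n m d × (Fin n → EuclideanSpace ℝ (Fin d)) :=
  (S.compStep x.1 J, x.2)

variable {S}

theorem Consistent.commAug {x : State n m d × (Fin n → EuclideanSpace ℝ (Fin d))}
    (hx : S.Consistent x) : S.Consistent (S.commAug x) := by
  intro i
  have h := hx i
  have hσ := (S.σ_pos i).ne'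
  simp only [Problem.commAug, commStep, map_add, map_smul, Pi.add_apply, Pi.smul_apply, neg_add,
    ← h, smul_sub, ← matAct_apply]
  rw [smul_comm (S.σ i), smul_smul (S.σ i), mul_inv_cancel₀ hσ, one_smul]
  abel

theorem Consistent.compAug {x : State n m d × (Fin n → EuclideanSpace ℝ (Fin d))}
    (hx : S.Consistent x) (J : Fin n → Fin m) : S.Consistent (S.compAug x J) := by
  intro i
  have h := hx i
  have hσ := (S.σ_pos i).ne'
  have hsum : ∑ j, (∇ (S.f i j) (S.zNew x.1 J i j) - ∇ (S.f i j) (x.1.z i j)) =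
      ∇ (S.f i (J i)) (S.zNew x.1 J i (J i)) - ∇ (S.f i (J i)) (x.1.z i (J i)) :=
    Finset.sum_eq_single (J i) (fun j _ hj => by simp [zNew, hj]) (by simp)
  rw [Finset.sum_sub_distrib] at hsum
  simp only [Problem.compAug, compStep, ← h, smul_sub, smul_smul, mul_inv_cancel₀ hσ, one_smul]
  rw [sub_add, ← hsum]
  abel

variable (S)

theorem inner_gradDiff_nonneg (θs : EuclideanSpace ℝ (Fin d)) (i : Fin n) (j : Fin m)
    (z : EuclideanSpace ℝ (Fin d)) : 0 ≤ inner ℝ (z - θs) (S.gradDiff θs i j z) :=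
  monotone_gradient (S.convex i j) (S.differentiable i j) z θs

theorem matAct_W_sub {θs : EuclideanSpace ℝ (Fin d)}
    {ωs : Fin n → EuclideanSpace ℝ (Fin d)} (hs : S.Consistent (⟨fun _ => θs, fun _ _ => θs⟩, ωs))
    {x : State n m d × (Fin n → EuclideanSpace ℝ (Fin d))} (hx : S.Consistent x) (i : Fin n) :
    matAct S.W (x.2 - ωs) i =
      -(S.σ i • (x.1.θ i - θs) + ∑ j, S.gradDiff θs i j (x.1.z i j)) := by
  have h1 := hx i
  have h2 := hs i
  simp only at h2
  rw [map_sub, Pi.sub_apply, ← neg_neg (matAct S.W x.2 i), ← h1,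
    ← neg_neg (matAct S.W ωs i), ← h2, smul_sub]
  simp only [gradDiff, Finset.sum_sub_distrib]
  abel

/-- The relative strong convexity of the dual objective: the distance of the edge variables to the
optimal ones is controlled by the primal error and the symmetrized Bregman divergences. -/
theorem lamMinDM_mul_le {θs : EuclideanSpace ℝ (Fin d)}
    {ωs : Fin n → EuclideanSpace ℝ (Fin d)} (hs : S.Consistent (⟨fun _ => θs, fun _ _ => θs⟩, ωs))
    {x : State n m d × (Fin n → EuclideanSpace ℝ (Fin d))} (hx : S.Consistent x) :
    S.lamMinDM * ∑ e, ‖matAct (Acomm S.G S.μ)ᵀ (x.2 - ωs) e‖ ^ 2 ≤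
      ∑ i, S.σ i * ‖x.1.θ i - θs‖ ^ 2 +
        ∑ i, ∑ j, inner ℝ (x.1.z i j - θs) (S.gradDiff θs i j (x.1.z i j)) := by
  refine (le_sum_norm_sq_matAct_transpose (Acomm S.G S.μ)
    (fun i => inv_pos.2 (S.DM_pos i)) (x.2 - ωs)).trans ?_
  rw [← Finset.sum_add_distrib]
  refine Finset.sum_le_sum fun i _ => ?_
  rw [inv_mul_le_iff₀ (S.DM_pos i), ← matAct_W]
  rw [S.matAct_W_sub hs hx, norm_neg]
  exact norm_sq_add_le (S.σ_pos i).le (S.lamMax_sumLP_nonneg i)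
    (Finset.sum_nonneg fun j _ => S.inner_gradDiff_nonneg θs i j _)
    (S.norm_sq_le_lamMax_sumLP i
      (fun j => gradient_sub_mem_kerHess_orthogonal (S.convex i j) (S.differentiable i j) _ _)
      (fun j => S.inner_gradDiff_nonneg θs i j _)
      fun j => cocoercive (S.convex i j) (S.differentiable i j) (S.smooth i j) _ _)

theorem matAct_Acomm_transpose_sub_const (θ : Fin n → EuclideanSpace ℝ (Fin d))
    (v : EuclideanSpace ℝ (Fin d)) :
    matAct (Acomm S.G S.μ)ᵀ (fun i => θ i - v) = matAct (Acomm S.G S.μ)ᵀ θ := by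
  rw [show (fun i => θ i - v) = θ - fun _ => v from rfl, map_sub,
    matAct_Acomm_transpose_const, sub_zero]

theorem energy_commAug_le (hn : 2 ≤ n) (hm : 1 ≤ m) {θs : EuclideanSpace ℝ (Fin d)}
    {ωs : Fin n → EuclideanSpace ℝ (Fin d)} (hs : S.Consistent (⟨fun _ => θs, fun _ _ => θs⟩, ωs))
    {x : State n m d × (Fin n → EuclideanSpace ℝ (Fin d))} (hx : S.Consistent x) :
    S.pcomm * (S.energy θs ωs (S.commAug x) - S.energy θs ωs x) ≤
      S.lamMinDM * S.η * (-(3 / 2) * ∑ i, S.σ i * ‖x.1.θ i - θs‖ ^ 2 -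
        2 * ∑ i, ∑ j, inner ℝ (x.1.θ i - θs) (S.gradDiff θs i j (x.1.z i j))) := by
  set A := Acomm S.G S.μ with hA
  set e : Fin n → EuclideanSpace ℝ (Fin d) := fun i => x.1.θ i - θs with he
  set δ := x.2 - ωs with hδ
  set h := S.η / S.pcomm with hh
  set Λ := S.lamMaxSig
  set l := S.lamMinDM with hl
  set T := ∑ i, S.σ i * ‖e i‖ ^ 2 with hT
  set N := ∑ k, ‖matAct Aᵀ e k‖ ^ 2 with hN
  set R := ∑ i, inner ℝ (e i) (matAct S.W δ i) with hR
  have hp := S.pcomm_pos hn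
  have hη := S.η_pos hn hm
  have hΛ := S.lamMaxSig_pos hn
  have hlpos := S.lamMinDM_pos hn
  have hh0 : 0 < h := div_pos hη hp
  have hhΛ : h * Λ ≤ 1 := S.η_div_pcomm_mul_le hn
  have hlΛ : l ≤ Λ := S.lamMinDM_le_lamMaxSig hn
  have hN0 : 0 ≤ N := Finset.sum_nonneg fun _ _ => sq_nonneg _
  have hT0 : 0 ≤ T := Finset.sum_nonneg fun i _ => mul_nonneg (S.σ_pos i).le (sq_nonneg _)
  have hNT : N ≤ Λ * T := by
    have := sum_norm_sq_matAct_transpose_le (B := A) (c := fun i => (S.σ i)⁻¹)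
      (fun i => inv_pos.2 (S.σ_pos i)) e
    simp only [inv_inv] at this
    exact this
  have hWθ : matAct S.W x.1.θ = matAct S.W e := by
    rw [matAct_W, matAct_W, he, matAct_Acomm_transpose_sub_const]
  -- the edge variables
  have hdual : ∑ k, ‖matAct Aᵀ (x.2 + h • x.1.θ - ωs) k‖ ^ 2 =
      ∑ k, ‖matAct Aᵀ δ k‖ ^ 2 + 2 * h * R + h ^ 2 * N := by
    rw [hR, sum_inner_matAct_W, Finset.mul_sum, hN, Finset.mul_sum, ← Finset.sum_add_distrib,
      ← Finset.sum_add_distrib]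
    refine Finset.sum_congr rfl fun k _ => ?_
    rw [add_sub_right_comm, ← hδ, map_add, map_smul, ← hA,
      ← S.matAct_Acomm_transpose_sub_const x.1.θ θs, Pi.add_apply, Pi.smul_apply, norm_add_sq_real,
      norm_smul, inner_smul_right, Real.norm_of_nonneg hh0.le, real_inner_comm]
    ring
  -- the primal error
  have hprimal : ∑ i, S.σ i * ‖(S.commStep x.1).θ i - θs‖ ^ 2 ≤ T - h * N := by
    have h1 : ∀ i, S.σ i * ‖(S.commStep x.1).θ i - θs‖ ^ 2 = S.σ i * ‖e i‖ ^ 2 -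
        2 * h * inner ℝ (e i) (matAct S.W e i) + h ^ 2 * ((S.σ i)⁻¹ * ‖matAct S.W e i‖ ^ 2) := by
      intro i
      have hσ := S.σ_pos i
      have : (S.commStep x.1).θ i - θs = e i - (h * (S.σ i)⁻¹) • matAct S.W e i := by
        rw [← hWθ, matAct_apply, ← smul_smul]
        simp only [commStep, he]
        abel
      rw [this, norm_sub_sq_real, inner_smul_right, norm_smul, Real.norm_of_nonneg (by positivity)]
      field_simp
    have h2 : ∑ i, inner ℝ (e i) (matAct S.W e i) = N := by
      rw [sum_inner_matAct_W]
      simp only [real_inner_self_eq_norm_sq, hN, hA]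
    have h3 : ∑ i, (S.σ i)⁻¹ * ‖matAct S.W e i‖ ^ 2 ≤ Λ * N := by
      rw [matAct_W]
      exact sum_norm_sq_matAct_le A _ _
    simp only [h1, Finset.sum_add_distrib, Finset.sum_sub_distrib, ← Finset.mul_sum, h2]
    have h4 := mul_le_mul_of_nonneg_left h3 (sq_nonneg h)
    have h5 := mul_le_mul_of_nonneg_right hhΛ (mul_nonneg hh0.le hN0)
    nlinarith
  -- the coupling between them
  have hRT : R = -T - ∑ i, ∑ j, inner ℝ (e i) (S.gradDiff θs i j (x.1.z i j)) := by
    rw [hR, hT, neg_sub_left, ← Finset.sum_add_distrib, ← Finset.sum_neg_distrib]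
    refine Finset.sum_congr rfl fun i _ => ?_
    rw [hδ, S.matAct_W_sub hs hx, inner_neg_right, inner_add_right, inner_smul_right, real_inner_self_eq_norm_sq,
      inner_sum, add_comm]
  -- since `h λ_max ≤ 1` and `λ_min⁺ ≤ λ_max`, the second-order terms cost at most `λ_min⁺ T / 2`
  have hquad : N * (l * h - 1 / 2) ≤ 1 / 2 * l * T := by
    rcases le_or_gt (l * h) (1 / 2) with h1 | h1
    · have : N * (l * h - 1 / 2) ≤ 0 := mul_nonpos_of_nonneg_of_nonpos hN0 (by linarith)
      exact this.trans (by positivity)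
    · have h2 : Λ * (l * h - 1 / 2) ≤ 1 / 2 * l := by nlinarith
      calc _ ≤ (Λ * T) * (l * h - 1 / 2) :=
            mul_le_mul_of_nonneg_right hNT (by linarith)
        _ = (Λ * (l * h - 1 / 2)) * T := by ring
        _ ≤ _ := mul_le_mul_of_nonneg_right h2 hT0
  have hdiff : S.energy θs ωs (S.commAug x) - S.energy θs ωs x ≤
      h * (2 * l * R + N * (l * h - 1 / 2)) := by
    simp only [energy, Problem.commAug]
    rw [← hA, ← hl, ← hh, hdual, ← hδ, show (S.commStep x.1).z = x.1.z from rfl]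
    have : ∑ i, S.σ i * ‖x.1.θ i - θs‖ ^ 2 = T := rfl
    rw [this]
    linarith
  calc _ ≤ S.pcomm * (h * (2 * l * R + N * (l * h - 1 / 2))) :=
        mul_le_mul_of_nonneg_left hdiff hp.le
    _ = S.η * (2 * l * R + N * (l * h - 1 / 2)) := by
        rw [← mul_assoc, hh, mul_div_cancel₀ _ hp.ne']
    _ ≤ S.η * (2 * l * R + 1 / 2 * l * T) := by gcongr
    _ = _ := by rw [hRT]; ring

end Energy

end Problem

end DVR

/-! ### Computation steps, convergence and running time -/

namespace DVR

/-- The effect of a computation step at one node. For `q = θ - z` and the variation `a` of the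
gradient, it amounts to `‖a‖² / 2σ ≤ (1 - β) ⟪q, a⟫`, which follows from cocoercivity
when `β (1 + L / σ) ≤ 1`. -/
theorem node_energy_sub_le {E : Type*} [NormedAddCommGroup E] [InnerProductSpace ℝ E]
    [CompleteSpace E] {f : E → ℝ} {L : NNReal} (hc : ConvexOn ℝ Set.univ f)
    (hd : Differentiable ℝ f) (hL : LipschitzWith L (∇ f)) {σ β : ℝ} (hσ : 0 < σ) (hβ : 0 < β)
    (hβL : β * (1 + L / σ) ≤ 1) (θ z θs : E) :
    1 / 2 * σ * ‖θ - σ⁻¹ • (∇ f ((1 - β) • z + β • θ) - ∇ f z) - θs‖ ^ 2 -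
        1 / 2 * σ * ‖θ - θs‖ ^ 2 +
        (inner ℝ ((1 - β) • z + β • θ - θs) (∇ f ((1 - β) • z + β • θ) - ∇ f θs) -
          inner ℝ (z - θs) (∇ f z - ∇ f θs)) ≤
      -β * inner ℝ (z - θ) (∇ f z - ∇ f θs) := by
  set z' := (1 - β) • z + β • θ with hz'
  set a := ∇ f z' - ∇ f z with ha
  set h := ∇ f z - ∇ f θs with hh
  set e := θ - θs with he
  set q := θ - z with hq
  have e1 : z' - z = β • q := by rw [hz', hq, sub_smul, one_smul, smul_sub]; abel
  have e2 : z' - θs = e - (1 - β) • q := by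
    rw [hz', he, hq, smul_sub, sub_smul, sub_smul, one_smul, one_smul]; abel
  have e3 : ∇ f z' - ∇ f θs = h + a := by rw [ha, hh]; abel
  have e4 : z - θs = e - q := by rw [he, hq]; abel
  have e5 : z - θ = -q := by rw [hq]; abel
  have e6 : θ - σ⁻¹ • a - θs = e - σ⁻¹ • a := by rw [he]; abel
  have h1 := cocoercive hc hd hL z' z
  have h2 := monotone_gradient hc hd z' z
  rw [← ha, e1, inner_smul_left, conj_trivial] at h1 h2
  have h3 : 0 ≤ inner ℝ q a := nonneg_of_mul_nonneg_right h2 hβ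
  have h4 : ‖a‖ ^ 2 / σ ≤ (1 - β) * inner ℝ q a := by
    have h5 : β * (L / σ) ≤ 1 - β := by linarith
    calc _ ≤ L * (β * inner ℝ q a) / σ := by gcongr
      _ = β * (L / σ) * inner ℝ q a := by ring
      _ ≤ _ := by gcongr
  have h6 : 1 / 2 * σ * ‖e - σ⁻¹ • a‖ ^ 2 =
      1 / 2 * σ * ‖e‖ ^ 2 - inner ℝ e a + ‖a‖ ^ 2 / σ / 2 := by
    rw [norm_sub_sq_real, norm_smul, inner_smul_right, Real.norm_of_nonneg (inv_nonneg.2 hσ.le)]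
    field_simp
  have h7 : 0 ≤ ‖a‖ ^ 2 / σ := by positivity
  rw [e2, e3, e4, e5, e6, h6]
  simp only [inner_sub_left, inner_add_right, inner_neg_left, inner_smul_left, conj_trivial]
  linarith

namespace Problem

variable {n m d : ℕ} (S : Problem n m d)

section OneStep

theorem energy_compAug_le (hn : 2 ≤ n) (hm : 1 ≤ m) (θs : EuclideanSpace ℝ (Fin d))
    (ωs : Fin n → EuclideanSpace ℝ (Fin d))
    (x : State n m d × (Fin n → EuclideanSpace ℝ (Fin d))) (J : Fin n → Fin m) :
    S.energy θs ωs (S.compAug x J) ≤ S.energy θs ωs x + ∑ i, -(S.α * S.η / S.p i (J i)) *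
      inner ℝ (x.1.z i (J i) - x.1.θ i) (S.gradDiff θs i (J i) (x.1.z i (J i))) := by
  have hnode : ∀ i, 1 / 2 * S.σ i * ‖(S.compStep x.1 J).θ i - θs‖ ^ 2 -
      1 / 2 * S.σ i * ‖x.1.θ i - θs‖ ^ 2 +
      (∑ j, inner ℝ (S.zNew x.1 J i j - θs) (S.gradDiff θs i j (S.zNew x.1 J i j)) -
        ∑ j, inner ℝ (x.1.z i j - θs) (S.gradDiff θs i j (x.1.z i j))) ≤
      -(S.α * S.η / S.p i (J i)) *
      inner ℝ (x.1.z i (J i) - x.1.θ i) (S.gradDiff θs i (J i) (x.1.z i (J i))) := by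
    intro i
    have hβ : 0 < S.α * S.η / S.p i (J i) :=
      div_pos (mul_pos (S.α_pos hn) (S.η_pos hn hm)) (S.p_pos hn i (J i))
    have h := node_energy_sub_le (S.convex i (J i)) (S.differentiable i (J i))
      (S.smooth i (J i)) (S.σ_pos i) hβ (S.step_mul_le hn i (J i)) (x.1.θ i) (x.1.z i (J i)) θs
    rw [← Finset.sum_sub_distrib, Finset.sum_eq_single (J i)
      (fun j _ hj => by simp [zNew, hj]) (by simp)]
    have hz : S.zNew x.1 J i (J i) = (1 - S.α * S.η / S.p i (J i)) • x.1.z i (J i) +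
      (S.α * S.η / S.p i (J i)) • x.1.θ i := by simp [zNew]
    simp only [compStep, hz]
    exact h
  have hsum := Finset.sum_le_sum fun i (_ : i ∈ Finset.univ) => hnode i
  simp only [Finset.sum_add_distrib, Finset.sum_sub_distrib, mul_assoc, ← Finset.mul_sum] at hsum
  simp only [energy, Problem.compAug]
  rw [show (S.compStep x.1 J).z = S.zNew x.1 J from rfl]
  linarith

/-- The law of the index sampled by node `i` in a computation step. -/
def nodeLaw (i : Fin n) : Measure (Fin m) :=
  ∑ j, ENNReal.ofReal (S.p i j / (1 - S.pcomm)) • Measure.dirac j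

theorem isProbabilityMeasure_nodeLaw (hn : 2 ≤ n) (hm : 1 ≤ m) (i : Fin n) :
    IsProbabilityMeasure (S.nodeLaw i) := by
  have h1 : 0 < 1 - S.pcomm := sub_pos.2 (S.pcomm_lt_one hn)
  constructor
  simp only [nodeLaw, Measure.finsetSum_apply, Measure.smul_apply, measure_univ, smul_eq_mul,
    mul_one]
  rw [← ENNReal.ofReal_sum_of_nonneg fun j _ => (div_pos (S.p_pos hn i j) h1).le,
    ← Finset.sum_div, S.sum_p hm, div_self h1.ne', ENNReal.ofReal_one]

theorem integral_nodeLaw (hn : 2 ≤ n) (i : Fin n) (φ : Fin m → ℝ) :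
    ∫ j, φ j ∂(S.nodeLaw i) = ∑ j, S.p i j / (1 - S.pcomm) * φ j := by
  rw [nodeLaw, integral_finsetSum_measure fun j _ =>
    (integrable_dirac (by simp)).smul_measure ENNReal.ofReal_ne_top]
  refine Finset.sum_congr rfl fun j _ => ?_
  rw [integral_smul_measure, integral_dirac, smul_eq_mul, ENNReal.toReal_ofReal
    (div_pos (S.p_pos hn i j) (sub_pos.2 (S.pcomm_lt_one hn))).le]

/-- The energy contracts in conditional expectation. -/
theorem expected_energy_step_le (hn : 2 ≤ n) (hm : 1 ≤ m) {θs : EuclideanSpace ℝ (Fin d)}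
    {ωs : Fin n → EuclideanSpace ℝ (Fin d)} (hs : S.Consistent (⟨fun _ => θs, fun _ _ => θs⟩, ωs))
    {x : State n m d × (Fin n → EuclideanSpace ℝ (Fin d))} (hx : S.Consistent x) :
    S.pcomm * S.energy θs ωs (S.commAug x) +
        (1 - S.pcomm) * ∫ J, S.energy θs ωs (S.compAug x J) ∂(Measure.pi S.nodeLaw) ≤
      (1 - S.α * S.η / 2) * S.energy θs ωs x := by
  have hprob := S.isProbabilityMeasure_nodeLaw hn hm
  have h1 : 0 < 1 - S.pcomm := sub_pos.2 (S.pcomm_lt_one hn)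
  have hη := S.η_pos hn hm
  have hcomp : (1 - S.pcomm) * ∫ J, S.energy θs ωs (S.compAug x J) ∂(Measure.pi S.nodeLaw) ≤
      (1 - S.pcomm) * S.energy θs ωs x - S.α * S.η * ∑ i, ∑ j,
        inner ℝ (x.1.z i j - x.1.θ i) (S.gradDiff θs i j (x.1.z i j)) := by
    have hmono : ∫ J, S.energy θs ωs (S.compAug x J) ∂(Measure.pi S.nodeLaw) ≤ _ :=
      integral_mono .of_finite .of_finite (S.energy_compAug_le hn hm θs ωs x)
    rw [integral_add .of_finite .of_finite, integral_const, probReal_univ, one_smul,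
      integral_finsetSum _ fun _ _ => .of_finite] at hmono
    have hi : ∀ i, ∫ J, -(S.α * S.η / S.p i (J i)) * inner ℝ (x.1.z i (J i) - x.1.θ i)
        (S.gradDiff θs i (J i) (x.1.z i (J i))) ∂(Measure.pi S.nodeLaw) =
        -(S.α * S.η / (1 - S.pcomm)) * ∑ j,
          inner ℝ (x.1.z i j - x.1.θ i) (S.gradDiff θs i j (x.1.z i j)) := by
      intro i
      rw [integral_comp_eval (μ := S.nodeLaw) (i := i)
        (f := fun j => -(S.α * S.η / S.p i j) * inner ℝ (x.1.z i j - x.1.θ i)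
        (S.gradDiff θs i j (x.1.z i j))) (measurable_of_finite _).aestronglyMeasurable,
        S.integral_nodeLaw hn, Finset.mul_sum]
      refine Finset.sum_congr rfl fun j _ => ?_
      have := (S.p_pos hn i j).ne'
      field_simp
    simp only [hi, ← Finset.mul_sum] at hmono
    refine (mul_le_mul_of_nonneg_left hmono h1.le).trans (le_of_eq ?_)
    field_simp
    ring
  have hcomm := S.energy_commAug_le hn hm hs hx
  have hdual := S.lamMinDM_mul_le hs hx
  have hsplit : ∑ i, ∑ j, inner ℝ (x.1.z i j - θs) (S.gradDiff θs i j (x.1.z i j)) =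
      ∑ i, ∑ j, inner ℝ (x.1.z i j - x.1.θ i) (S.gradDiff θs i j (x.1.z i j)) +
      ∑ i, ∑ j, inner ℝ (x.1.θ i - θs) (S.gradDiff θs i j (x.1.z i j)) := by
    simp only [← Finset.sum_add_distrib, ← inner_add_left, sub_add_sub_cancel]
  have hle : S.energy θs ωs x ≤ 3 / 2 * ∑ i, S.σ i * ‖x.1.θ i - θs‖ ^ 2 +
      2 * ∑ i, ∑ j, inner ℝ (x.1.z i j - θs) (S.gradDiff θs i j (x.1.z i j)) := by
    rw [energy]
    linarith
  have hfinal := mul_le_mul_of_nonneg_left hle (mul_pos (S.lamMinDM_pos hn) hη).le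
  rw [hsplit] at hfinal
  rw [α] at hcomp ⊢
  linarith

end OneStep

section Convergence

theorem sum_smul_add_gradient_eq_zero {θs : EuclideanSpace ℝ (Fin d)}
    (hmin : IsMinOn S.F Set.univ θs) :
    ∑ i, (S.σ i • θs + ∑ j, ∇ (S.f i j) θs) = 0 := by
  set v := ∑ i, (S.σ i • θs + ∑ j, ∇ (S.f i j) θs) with hv
  have hF : HasFDerivAt S.F (∑ i, ((S.σ i / 2) • (2 • innerSL ℝ θs) +
      ∑ j, fderiv ℝ (S.f i j) θs)) θs :=
    HasFDerivAt.fun_sum fun i _ =>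
      ((hasStrictFDerivAt_norm_sq θs).hasFDerivAt.const_mul (S.σ i / 2)).add
        (HasFDerivAt.fun_sum fun j _ => (S.differentiable i j θs).hasFDerivAt)
  have h0 := (hmin.isLocalMin Filter.univ_mem).hasFDerivAt_eq_zero hF
  have h1 : inner ℝ v v = (∑ i, ((S.σ i / 2) • (2 • innerSL ℝ θs) +
      ∑ j, fderiv ℝ (S.f i j) θs)) v := by
    nth_rw 1 [hv]
    simp only [sum_inner, inner_add_left, inner_smul_left, inner_gradient_left, conj_trivial,
      _root_.sum_apply, _root_.add_apply,
      _root_.smul_apply, innerSL_apply_apply, smul_eq_mul, nsmul_eq_mul]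
    refine Finset.sum_congr rfl fun i _ => ?_
    push_cast
    ring
  have h2 : inner ℝ v v = (0 : ℝ) := by
    rw [h1, h0]
    rfl
  exact inner_self_eq_zero.1 h2

/-- The minimizer corresponds to a consistent state, by the optimality condition. -/
theorem exists_consistent_minimizer {θs : EuclideanSpace ℝ (Fin d)}
    (hmin : IsMinOn S.F Set.univ θs) :
    ∃ ωs, S.Consistent (⟨fun _ => θs, fun _ _ => θs⟩, ωs) := by
  obtain ⟨x, hx⟩ := S.exists_matAct_W_eq (S.sum_smul_add_gradient_eq_zero hmin)
  exact ⟨-x, fun i => by rw [map_neg, hx, Pi.neg_apply, neg_neg]⟩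

theorem consistent_init (z₀ : Fin n → Fin m → EuclideanSpace ℝ (Fin d)) :
    S.Consistent (S.init z₀, 0) := by
  intro i
  simp [init, smul_smul, mul_inv_cancel₀ (S.σ_pos i).ne']

/-- The iterates of DVR together with the edge potential. -/
def iterAug (z₀ : Fin n → Fin m → EuclideanSpace ℝ (Fin d)) (r : ℕ → ℝ × (Fin n → Fin m)) (t : ℕ) :
    State n m d × (Fin n → EuclideanSpace ℝ (Fin d)) :=
  randIter S.pcomm S.commAug S.compAug (S.init z₀, 0) r t

theorem iterAug_fst (z₀ : Fin n → Fin m → EuclideanSpace ℝ (Fin d))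
    (r : ℕ → ℝ × (Fin n → Fin m)) (t : ℕ) : (S.iterAug z₀ r t).1 = S.iter z₀ r t := by
  induction t with
  | zero => rfl
  | succ t ih =>
    simp only [iter, step, ← ih, iterAug, randIter]
    split_ifs <;> rfl

theorem consistent_iterAug (z₀ : Fin n → Fin m → EuclideanSpace ℝ (Fin d))
    (r : ℕ → ℝ × (Fin n → Fin m)) (t : ℕ) : S.Consistent (S.iterAug z₀ r t) := by
  induction t with
  | zero => exact S.consistent_init z₀
  | succ t ih =>
    simp only [iterAug, randIter]
    split_ifs
    · exact ih.commAug
    · exact ih.compAug _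

theorem sum_half_mul_norm_sq_le_energy (hn : 2 ≤ n) (θs : EuclideanSpace ℝ (Fin d))
    (ωs : Fin n → EuclideanSpace ℝ (Fin d))
    (x : State n m d × (Fin n → EuclideanSpace ℝ (Fin d))) :
    ∑ i, 1 / 2 * (S.σ i * ‖x.1.θ i - θs‖ ^ 2) ≤ S.energy θs ωs x := by
  rw [energy, ← Finset.mul_sum]
  have h1 := mul_nonneg (S.lamMinDM_pos hn).le (Finset.sum_nonneg fun e (_ : e ∈ Finset.univ) =>
    sq_nonneg ‖matAct (Acomm S.G S.μ)ᵀ (x.2 - ωs) e‖)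
  have h2 : 0 ≤ ∑ i, ∑ j, inner ℝ (x.1.z i j - θs) (S.gradDiff θs i j (x.1.z i j)) :=
    Finset.sum_nonneg fun i _ => Finset.sum_nonneg fun j _ => S.inner_gradDiff_nonneg θs i j _
  linarith

variable {Ω : Type*} [MeasurableSpace Ω] {P : Measure Ω} [IsProbabilityMeasure P]
  {r : ℕ → Ω → ℝ × (Fin n → Fin m)}

theorem integral_energy_le (hn : 2 ≤ n) (hm : 1 ≤ m) {θs : EuclideanSpace ℝ (Fin d)}
    {ωs : Fin n → EuclideanSpace ℝ (Fin d)} (hs : S.Consistent (⟨fun _ => θs, fun _ _ => θs⟩, ωs))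
    (z₀ : Fin n → Fin m → EuclideanSpace ℝ (Fin d)) (hr : ∀ t, Measurable (r t))
    (hind : iIndepFun r P) (hlaw : ∀ t, P.map (r t) = S.sampleLaw) (t : ℕ) :
    ∫ ω, S.energy θs ωs (S.iterAug z₀ (fun k => r k ω) t) ∂P ≤
      (1 - S.α * S.η / 2) ^ t * S.energy θs ωs (S.init z₀, 0) := by
  have hprob := S.isProbabilityMeasure_nodeLaw hn hm
  have hrate : 0 ≤ 1 - S.α * S.η / 2 := by linarith [S.α_mul_η_le_one hn hm]
  induction t with
  | zero => simp [iterAug, randIter]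
  | succ t ih =>
    have hint := fun Φ => integrable_randIter (P := P) S.pcomm S.commAug S.compAug
      (S.init z₀, 0) hr t Φ
    calc _ = _ := integral_randIter_succ S.pcomm S.commAug S.compAug (S.init z₀, 0) hr hind
          (π := Measure.pi S.nodeLaw) (S.pcomm_pos hn).le (S.pcomm_lt_one hn).le (hlaw t) (S.energy θs ωs)
      _ ≤ ∫ ω, (1 - S.α * S.η / 2) * S.energy θs ωs (S.iterAug z₀ (fun k => r k ω) t) ∂P :=
          integral_mono (hint fun y => S.pcomm * S.energy θs ωs (S.commAug y) +
              (1 - S.pcomm) * ∫ J, S.energy θs ωs (S.compAug y J) ∂(Measure.pi S.nodeLaw))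
            ((hint (S.energy θs ωs)).const_mul _) fun ω =>
            S.expected_energy_step_le hn hm hs (S.consistent_iterAug z₀ _ t)
      _ ≤ _ := by
          rw [integral_const_mul, pow_succ', mul_assoc]
          exact mul_le_mul_of_nonneg_left ih hrate

theorem integrable_err (z₀ : Fin n → Fin m → EuclideanSpace ℝ (Fin d))
    (θs : EuclideanSpace ℝ (Fin d)) (hr : ∀ t, Measurable (r t)) (t : ℕ) :
    Integrable (fun ω => (S.iter z₀ (fun k => r k ω) t).err θs) P := by
  simp only [← iterAug_fst]
  exact integrable_randIter S.pcomm S.commAug S.compAug (S.init z₀, 0) hr t fun x => x.1.err θs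

theorem exists_err_le_mul_energy (hn : 2 ≤ n) (θs : EuclideanSpace ℝ (Fin d))
    (ωs : Fin n → EuclideanSpace ℝ (Fin d)) :
    ∃ b : ℝ, 0 < b ∧ ∀ x : State n m d × (Fin n → EuclideanSpace ℝ (Fin d)),
      x.1.err θs ≤ b * S.energy θs ωs x := by
  have : Nonempty (Fin n) := ⟨⟨0, by omega⟩⟩
  obtain ⟨i₀, hi₀⟩ := Finite.exists_min S.σ
  refine ⟨(S.σ i₀)⁻¹, inv_pos.2 (S.σ_pos i₀), fun x => ?_⟩
  rw [le_inv_mul_iff₀ (S.σ_pos i₀)]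
  refine le_trans ?_ (S.sum_half_mul_norm_sq_le_energy hn θs ωs x)
  rw [State.err, Finset.mul_sum]
  refine Finset.sum_le_sum fun i _ => ?_
  nlinarith [mul_le_mul_of_nonneg_right (hi₀ i) (sq_nonneg ‖x.1.θ i - θs‖)]

end Convergence

section Time

variable {Ω : Type*} [MeasurableSpace Ω] {P : Measure Ω} [IsProbabilityMeasure P]
  {r : ℕ → Ω → ℝ × (Fin n → Fin m)}

theorem integrable_time_and_integral_eq (hn : 2 ≤ n) (hm : 1 ≤ m) (hr : ∀ t, Measurable (r t))
    (hlaw : ∀ t, P.map (r t) = S.sampleLaw) (τ : ℝ) (K : ℕ) :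
    Integrable (fun ω => S.time τ (fun k => r k ω) K) P ∧
      ∫ ω, S.time τ (fun k => r k ω) K ∂P = K * (S.pcomm * τ + (1 - S.pcomm)) := by
  have hprob := S.isProbabilityMeasure_nodeLaw hn hm
  let A : Set (ℝ × (Fin n → Fin m)) := Set.Iic S.pcomm ×ˢ Set.univ
  have hA : MeasurableSet A := measurableSet_Iic.prod .univ
  have hterm : ∀ t ω, (if (r t ω).1 ≤ S.pcomm then τ else 1) =
      1 + (τ - 1) * (r t ⁻¹' A).indicator 1 ω := by
    intro t ω
    by_cases h : (r t ω).1 ≤ S.pcomm <;> simp [A, Set.indicator, h]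
  have hi : ∀ t, Integrable ((r t ⁻¹' A).indicator (1 : Ω → ℝ)) P := fun t =>
    (integrable_const (1 : ℝ)).indicator (hr t hA)
  have hm : ∀ t, ∫ ω, (r t ⁻¹' A).indicator (1 : Ω → ℝ) ω ∂P = S.pcomm := by
    intro t
    rw [integral_indicator_one (hr t hA), ← map_measureReal_apply (hr t) hA, hlaw,
      show S.sampleLaw = (volume.restrict (Set.Icc (0 : ℝ) 1)).prod (Measure.pi S.nodeLaw)
        from rfl, measureReal_prod_prod,
      restrict_Icc_real_Iic (S.pcomm_pos hn).le (S.pcomm_lt_one hn).le, probReal_univ, mul_one]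
  have hint : ∀ t, Integrable (fun ω => 1 + (τ - 1) * (r t ⁻¹' A).indicator (1 : Ω → ℝ) ω) P :=
    fun t => (integrable_const _).add ((hi t).const_mul _)
  simp only [time, hterm]
  refine ⟨integrable_finsetSum _ fun t _ => hint t, ?_⟩
  rw [integral_finsetSum _ fun t _ => hint t]
  simp only [integral_add (integrable_const (1 : ℝ)) ((hi _).const_mul (τ - 1)),
    integral_const_mul, hm, integral_const, probReal_univ, one_smul, Finset.sum_const,
    Finset.card_range, nsmul_eq_mul]
  ring

/-- The trade-off that `p_comm` is tuned for: relative to its contraction `α η`, an iteration has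
expected time at most `(m + κ_s) + τ κ_comm / γ`. -/
theorem expected_step_time_le (hn : 2 ≤ n) (hm : 1 ≤ m) {τ : ℝ} (hτ : 0 ≤ τ) :
    S.pcomm * τ + (1 - S.pcomm) ≤
      S.α * S.η * ((m + S.κs) + τ * (S.κcomm / S.γ)) := by
  have hα := S.α_pos hn
  have hγ := S.γ_pos hn
  have hκ := S.κcomm_pos hn
  have hκs := S.κs_pos hn
  have h := S.le_η hn hm
  rw [div_le_iff₀ hα] at h
  calc _ = (S.pcomm * (S.γ / S.κcomm)) * ((m + S.κs) + τ * (S.κcomm / S.γ)) := by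
        rw [S.one_sub_pcomm hn]
        field_simp
        ring
    _ ≤ (S.η * S.α) * ((m + S.κs) + τ * (S.κcomm / S.γ)) := by gcongr
    _ = _ := by ring

end Time

/-- A geometric decay at rate `1 - ρ / 2`, with `C ε ≤ 1`, brings the error below `ε` in
`⌈4 ρ⁻¹ log ε⁻¹⌉` steps, since the decay is then at most `ε²`. -/
theorem mul_pow_le_of_ceil_le {C ρ ε : ℝ} (hC : 0 < C) (hρ : 0 < ρ) (hρ1 : ρ ≤ 1) (hε : 0 < ε)
    (hCε : C * ε ≤ 1) {t : ℕ} (ht : 4 / ρ * Real.log ε⁻¹ ≤ t) :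
    C * (1 - ρ / 2) ^ t ≤ ε := by
  have h1 : (1 - ρ / 2) ^ t ≤ ε ^ 2 := by
    calc (1 - ρ / 2) ^ t ≤ Real.exp (-(ρ / 2)) ^ t :=
          pow_le_pow_left₀ (by linarith) (Real.one_sub_le_exp_neg _) t
      _ = Real.exp (t * -(ρ / 2)) := (Real.exp_nat_mul _ t).symm
      _ ≤ Real.exp (2 * Real.log ε) := by
          rw [Real.exp_le_exp]
          rw [Real.log_inv] at ht
          have h2 := mul_le_mul_of_nonneg_right ht hρ.le
          have h3 : 4 / ρ * -Real.log ε * ρ = -4 * Real.log ε := by field_simp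
          rw [h3] at h2
          linarith
      _ = ε ^ 2 := by
          rw [two_mul, Real.exp_add, Real.exp_log hε, sq]
  calc _ ≤ C * ε ^ 2 := by gcongr
    _ = (C * ε) * ε := by ring
    _ ≤ 1 * ε := by gcongr
    _ = ε := one_mul ε

end Problem

end DVR

end

theorem theorem1 :
    ∃ c : ℝ, 0 < c ∧
      ∀ (n m d : ℕ), 2 ≤ n → 1 ≤ m →
      ∀ (S : DVR.Problem n m d) (θs : EuclideanSpace ℝ (Fin d)), IsMinOn S.F Set.univ θs →
      ∀ z₀ : Fin n → Fin m → EuclideanSpace ℝ (Fin d),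
      ∃ C₀ : ℝ, 0 < C₀ ∧
        ∀ (Ω : Type*) [MeasurableSpace Ω] (P : Measure Ω) [IsProbabilityMeasure P]
          (r : ℕ → Ω → ℝ × (Fin n → Fin m)),
          (∀ t, Measurable (r t)) → iIndepFun r P → (∀ t, P.map (r t) = S.sampleLaw) →
          (∀ t : ℕ,
            Integrable (fun ω => (S.iter z₀ (fun k => r k ω) t).err θs) P ∧
            ∫ ω, (S.iter z₀ (fun k => r k ω) t).err θs ∂P ≤
              C₀ * (1 - S.α * S.η / 2) ^ t) ∧
          (∀ τ : ℝ, 0 ≤ τ → ∀ ε : ℝ, 0 < ε → ε ≤ 1 / 2 → ε ≤ 1 / C₀ →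
            ∃ K : ℕ,
              (∀ t : ℕ, K ≤ t → ∫ ω, (S.iter z₀ (fun k => r k ω) t).err θs ∂P ≤ ε) ∧
              Integrable (fun ω => S.time τ (fun k => r k ω) K) P ∧
              ∫ ω, S.time τ (fun k => r k ω) K ∂P ≤
                c * ((2 * (m + S.κs) + τ * (S.κcomm / S.γ)) * Real.log ε⁻¹)) := by
  refine ⟨6, by norm_num, fun n m d hn hm S θs hmin z₀ => ?_⟩
  obtain ⟨ωs, hs⟩ := S.exists_consistent_minimizer hmin
  obtain ⟨b, hb, herr⟩ := S.exists_err_le_mul_energy hn θs ωs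
  have hρ : 0 < S.α * S.η := mul_pos (S.α_pos hn) (S.η_pos hn hm)
  have hρ1 := S.α_mul_η_le_one hn hm
  have hC : 0 < max 1 (b * S.energy θs ωs (S.init z₀, 0)) := lt_max_of_lt_left one_pos
  refine ⟨max 1 (b * S.energy θs ωs (S.init z₀, 0)), hC, ?_⟩
  intro Ω _ P _ r hr hind hlaw
  have hdecay : ∀ t : ℕ, ∫ ω, (S.iter z₀ (fun k => r k ω) t).err θs ∂P ≤
      max 1 (b * S.energy θs ωs (S.init z₀, 0)) * (1 - S.α * S.η / 2) ^ t := by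
    intro t
    have hE := DVR.integrable_randIter (P := P) S.pcomm S.commAug S.compAug (S.init z₀, 0) hr t
      (S.energy θs ωs)
    calc _ ≤ ∫ ω, b * S.energy θs ωs (S.iterAug z₀ (fun k => r k ω) t) ∂P :=
          integral_mono (S.integrable_err z₀ θs hr t) (hE.const_mul b) fun ω => by
            have h := herr (S.iterAug z₀ (fun k => r k ω) t)
            rwa [S.iterAug_fst] at h
      _ = b * ∫ ω, S.energy θs ωs (S.iterAug z₀ (fun k => r k ω) t) ∂P := integral_const_mul _ _
      _ ≤ b * ((1 - S.α * S.η / 2) ^ t * S.energy θs ωs (S.init z₀, 0)) := by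
          gcongr
          exact S.integral_energy_le hn hm hs z₀ hr hind hlaw t
      _ = (b * S.energy θs ωs (S.init z₀, 0)) * (1 - S.α * S.η / 2) ^ t := by ring
      _ ≤ _ := mul_le_mul_of_nonneg_right (le_max_right _ _) (pow_nonneg (by linarith) t)
  refine ⟨fun t => ⟨S.integrable_err z₀ θs hr t, hdecay t⟩, fun τ hτ ε hε hε2 hεC => ?_⟩
  have hlog : 1 / 2 ≤ Real.log ε⁻¹ := by
    have h1 : Real.log 2 ≤ Real.log ε⁻¹ :=
      Real.log_le_log two_pos (by rw [le_inv_comm₀ two_pos hε]; linarith)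
    linarith [Real.log_two_gt_d9]
  refine ⟨⌈4 / (S.α * S.η) * Real.log ε⁻¹⌉₊, fun t ht => (hdecay t).trans
    (DVR.Problem.mul_pow_le_of_ceil_le hC hρ hρ1 hε ?_ (Nat.ceil_le.1 ht)), ?_⟩
  · rw [le_div_iff₀ hC] at hεC
    rwa [mul_comm]
  obtain ⟨hint, heq⟩ := S.integrable_time_and_integral_eq hn hm hr hlaw τ
    ⌈4 / (S.α * S.η) * Real.log ε⁻¹⌉₊
  refine ⟨hint, heq.le.trans ?_⟩
  -- rounding up costs at most `1 ≤ 2 log ε⁻¹ / (α η)`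
  have hK : (⌈4 / (S.α * S.η) * Real.log ε⁻¹⌉₊ : ℝ) ≤ 6 / (S.α * S.η) * Real.log ε⁻¹ := by
    have h1 := (Nat.ceil_lt_add_one (show 0 ≤ 4 / (S.α * S.η) * Real.log ε⁻¹ by
      have : 0 ≤ Real.log ε⁻¹ := by linarith
      positivity)).le
    have h2 : 1 ≤ 2 / (S.α * S.η) * Real.log ε⁻¹ := by
      rw [div_mul_eq_mul_div, le_div_iff₀ hρ]
      linarith
    calc _ ≤ _ := h1
      _ ≤ 4 / (S.α * S.η) * Real.log ε⁻¹ + 2 / (S.α * S.η) * Real.log ε⁻¹ := by gcongr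
      _ = _ := by ring
  have hstep := S.expected_step_time_le hn hm hτ
  have hp0 := S.pcomm_pos hn
  have hp1 := S.pcomm_lt_one hn
  have hnn : 0 ≤ S.pcomm * τ + (1 - S.pcomm) :=
    add_nonneg (mul_nonneg hp0.le hτ) (sub_nonneg.2 hp1.le)
  have hκs := S.κs_pos hn
  have hlog0 : 0 ≤ Real.log ε⁻¹ := by linarith
  calc _ ≤ (6 / (S.α * S.η) * Real.log ε⁻¹) * (S.pcomm * τ + (1 - S.pcomm)) := by gcongr
    _ ≤ (6 / (S.α * S.η) * Real.log ε⁻¹) *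
          (S.α * S.η * ((m + S.κs) + τ * (S.κcomm / S.γ))) := by gcongr
    _ = 6 * (((m + S.κs) + τ * (S.κcomm / S.γ)) * Real.log ε⁻¹) := by
        have hα := (S.α_pos hn).ne'
        have hη := (S.η_pos hn hm).ne'
        field_simp
    _ ≤ _ := by
        gcongr
        have : (0 : ℝ) ≤ m := Nat.cast_nonneg m
        linarith
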